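/- **Notation.** For $f:\mathbb R^3\to\mathbb R$ differentiable near $\mathbf x\in\mathbb S^2$ put $\mathbf L_{\mathbf x}f=\mathbf x\times\nabla f(\mathbf x)$. Let $Y_\mu^\nu$ ($\mu\ge 0$, $-\mu\le\nu\le\mu$) be the real spherical harmonics which, with $m=|\nu|$ and $\theta$ the longitude of $\mathbf x=(x,y,z)\in\mathbb S^2$, are $$Y_\mu^\nu(\mathbf x)=\sqrt{\tfrac{2\mu+1}{4\pi}}\sqrt{\tfrac{(\mu-m)!}{(\mu+m)!}}\,(1-z^2)^{m/2}P_\mu^{(m)}(z)\cdot\begin{cases}\cos(m\theta)&\nu\ge0\\ \sin(m\theta)&\nu<0,\end{cases}$$ where $P_\mu$ is the Legendre polynomial, and let $\mathbf w_\mu^\nu=\mathbf L Y_\mu^\nu$, $\mu\ge1$, be the surface divergence-free vector spherical harmonics. The symbol $\sum'_\nu$ means that the term $\nu=0$ is halved. For a radial kernel $\phi$ with $\mathbf x\mapsto\phi(\|\mathbf x\|)$ of class $C^2$ on $\mathbb R^3$, let $\Phi_{\rm div}(\mathbf x,\mathbf y)=\mathbf L_{\mathbf x}\mathbf L_{\mathbf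 y}^T\phi(\|\mathbf x-\mathbf y\|)\in\mathbb R^{3\times3}$. Given nodes $\mathbf y_1,\dots,\mathbf y_n\in\mathbb S^2$, a list $(\mathbf u_j)_{j=1}^n$ in $\mathbb R^3$ is called tangent if $\mathbf u_j\perp\mathbf y_j$ for all $j$. A divergence-free RBF interpolant of tangent data $(\mathbf u_j)$ is a field $\mathbf s=\sum_{j=1}^n\Phi_{\rm div}(\cdot,\mathbf y_j)\mathbf c_j$ on $\mathbb S^2$, with $(\mathbf c_j)$ tangent, such that $\mathbf s(\mathbf y_i)=\mathbf u_i$ for all $i$. **Hypotheses.** Let $2n=\mu_0(\mu_0+2)$ and let the nodes $\mathbf y_1,\dots,\mathbf y_n\in\mathbb S^2$ be unisolvent for the divergence-free vector spherical harmonics of degree $\le\mu_0$: for every tangent $(\mathbf u_j)$ there are unique real numbers $a_{\mu,\nu}$ ($1\le\mu\le\mu_0$, $|\nu|\le\mu$) with $\sum_{\mu,\nu}a_{\mu,\nu}\mathbf w_\mu^\nu(\mathbf y_i)=\mathbf u_i$ for all $i$. Let $\phi_\varepsilon$, $\varepsilon>0$, be radial kernels that for all sufficiently small $\varepsilon$ are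 of class $C^2$ in the above sense and have on $\mathbb S^2$ the Mercer expansion $$\phi_\varepsilon(\|\mathbf x-\mathbf y\|)=\sum_{\mu=0}^\infty\sideset{}{'}\sum_{\nu=-\mu}^{\mu}c_{\mu,\varepsilon}\,\varepsilon^{2\mu}\,Y_\mu^\nu(\mathbf y)\,Y_\mu^\nu(\mathbf x)\qquad(\mathbf x,\mathbf y\in\mathbb S^2).$$ Assume that there are constants $C,\rho$ and $\delta>0$ such that for all sufficiently small $\varepsilon>0$: $|c_{\mu,\varepsilon}|\le C\rho^\mu$ for all $\mu\ge1$, and $|c_{\mu,\varepsilon}|\ge\delta$ for $1\le\mu\le\mu_0$. **Conclusion.** Let $\Phi_{{\rm div},\varepsilon}$ be the matrix kernel of $\phi_\varepsilon$ and let $V_\varepsilon$ be the span of the fields $\Phi_{{\rm div},\varepsilon}(\cdot,\mathbf y_j)\mathbf c$ on $\mathbb S^2$, $1\le j\le n$, $\mathbf c\perp\mathbf y_j$. 1. There are constants $M,\kappa$ such that for all sufficiently small $\varepsilon>0$ the space $V_\varepsilon$ has a basis $\mathbf b_{\mu,\nu}$ ($1\le\mu\le\mu_0$, $|\nu|\le\mu$),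 depending on $\varepsilon$, of the form $$\mathbf b_{\mu,\nu}=\mathbf w_\mu^\nu+\sum_{\mu'>\mu_0}\sum_{|\nu'|\le\mu'}r^{\mu,\nu}_{\mu',\nu'}\,\mathbf w_{\mu'}^{\nu'}\quad\text{pointwise on }\mathbb S^2,$$ with $|r^{\mu,\nu}_{\mu',\nu'}|\le M\kappa^{\mu'}\varepsilon^{2(\mu'-\mu)}$ for all $\mu'>\mu_0$, $|\nu'|\le\mu'$, and $\sup_{\mathbb S^2}\|\mathbf b_{\mu,\nu}-\mathbf w_\mu^\nu\|\le M\varepsilon^2$. 2. For all sufficiently small $\varepsilon>0$ (independently of the data) and every tangent data $(\mathbf u_j)$ there is exactly one tangent $(\mathbf c_j)$ for which $\sum_j\Phi_{{\rm div},\varepsilon}(\cdot,\mathbf y_j)\mathbf c_j$ is a divergence-free RBF interpolant of $(\mathbf u_j)$. 3. For every tangent data $(\mathbf u_j)$ there is exactly one $\mathbf p\in{\rm span}\{\mathbf w_\mu^\nu:1\le\mu\le\mu_0,\ |\nu|\le\mu\}$ with $\mathbf p(\mathbf y_i)=\mathbf u_i$ for all $i$, and the divergence-free RBF interpolants $\mathbf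 s_\varepsilon$ of $(\mathbf u_j)$ converge to $\mathbf p$ uniformly on $\mathbb S^2$ as $\varepsilon\to0^+$. -/

import Mathlib

open Filter Topology
open scoped Matrix

noncomputable section

namespace DivFreeRBF

/-- Euclidean three-space. -/
abbrev E3 : Type := EuclideanSpace ℝ (Fin 3)

/-- The unit sphere of Euclidean three-space. -/
abbrev S2 : Type := Metric.sphere (0 : E3) 1

/-- The surface curl operator `(L f)(x) = x × ∇f(x)`, in Cartesian coordinates. At a point `x` of
the sphere it only involves derivatives of `f` in directions tangent to the sphere, so it depends
only on the restriction of `f` to the sphere. -/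
def rotc (f : E3 → ℝ) (x : E3) : E3 :=
  WithLp.toLp 2 ((WithLp.ofLp x) ⨯₃ (WithLp.ofLp (gradient f x)))

/-- The matrix kernel `Φ_div(x, y) = L_x L_yᵀ φ(‖x - y‖)`: its `(i, k)` entry is the `i`-th
component of `L_x` applied to the `k`-th component of `L_y φ(‖x - y‖)`. -/
def divKernel (φ : ℝ → ℝ) (x y : E3) : Matrix (Fin 3) (Fin 3) ℝ :=
  Matrix.of fun i k => rotc (fun x' => rotc (fun y' => φ ‖x' - y'‖) y k) x i

/-- The Legendre polynomial of degree `μ`, by the Rodrigues formula. -/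
def legendreP (μ : ℕ) : Polynomial ℝ :=
  Polynomial.C (1 / (2 ^ μ * (μ.factorial : ℝ))) *
    Polynomial.derivative^[μ] ((Polynomial.X ^ 2 - 1) ^ μ)

/-- The real scalar spherical harmonic of degree `μ` and order `ν`, `|ν| ≤ μ`, as a polynomial in
the Cartesian coordinates of `ℝ³`. With `m = |ν|`, at a point `(x, y, z)` of the sphere with
longitude `θ` one has `(1 - z²)^(m/2) cos (m θ) = Re ((x + i y)^m)` and similarly for the sine, so
on the sphere this is
`√((2μ+1)/(4π)) √((μ-m)!/(μ+m)!) P_μ^m(z) cos (m θ)` for `ν ≥ 0` and the same expression with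
`sin (m θ)` for `ν < 0`, where `P_μ^m(z) = (1 - z²)^(m/2) (d/dz)^m P_μ(z)`. -/
def sphY (μ : ℕ) (ν : ℤ) (x : E3) : ℝ :=
  √((2 * (μ : ℝ) + 1) / (4 * Real.pi)) *
    √(((μ - ν.natAbs).factorial : ℝ) / ((μ + ν.natAbs).factorial : ℝ)) *
    (Polynomial.derivative^[ν.natAbs] (legendreP μ)).eval (x 2) *
    (if 0 ≤ ν then (((x 0 : ℂ) + (x 1 : ℂ) * Complex.I) ^ ν.natAbs).re
      else (((x 0 : ℂ) + (x 1 : ℂ) * Complex.I) ^ ν.natAbs).im)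

/-- The surface div-free vector spherical harmonic `w_μ^ν = L Y_μ^ν`, as a field on the sphere. -/
def vsh (μ : ℕ) (ν : ℤ) : S2 → E3 := fun x => rotc (sphY μ ν) x

/-- The weight of the order `ν` in a primed sum: the term `ν = 0` is halved. -/
def primeWeight (ν : ℤ) : ℝ := if ν = 0 then 1 / 2 else 1

/-- The pairs `(μ, ν)` with `1 ≤ μ ≤ μ₀` and `-μ ≤ ν ≤ μ`; there are `μ₀ (μ₀ + 2)` of them. -/
def vshIndex (μ₀ : ℕ) : Finset (Σ _ : ℕ, ℤ) :=
  (Finset.Icc 1 μ₀).sigma fun μ => Finset.Icc (-(μ : ℤ)) (μ : ℤ)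

/-- The space spanned by the div-free vector spherical harmonics of degree at most `μ₀`. -/
def vshSpace (μ₀ : ℕ) : Submodule ℝ (S2 → E3) :=
  Submodule.span ℝ (Set.range fun k : vshIndex μ₀ => vsh k.1.1 k.1.2)

/-- `u` is a choice of vectors tangent to the sphere at the nodes `y`. -/
def IsTangent {n : ℕ} (y : Fin n → S2) (u : Fin n → E3) : Prop :=
  ∀ j, inner ℝ (y j : E3) (u j) = 0

/-- The nodes `y` are unisolvent for the div-free vector spherical harmonics of degree at most
`μ₀`: the linear system of the interpolation problem in the basis `w_μ^ν` has exactly one solution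
for every tangent right-hand side. -/
def Unisolvent {n : ℕ} (μ₀ : ℕ) (y : Fin n → S2) : Prop :=
  ∀ u : Fin n → E3, IsTangent y u →
    ∃! a : vshIndex μ₀ → ℝ, ∀ i, ∑ k, a k • vsh k.1.1 k.1.2 (y i) = u i

/-- The field `x ↦ ∑ⱼ Φ_div(x, yⱼ) cⱼ` on the sphere. -/
def rbfField {n : ℕ} (φ : ℝ → ℝ) (y : Fin n → S2) (c : Fin n → E3) : S2 → E3 :=
  fun x => ∑ j, Matrix.toEuclideanLin (divKernel φ x (y j)) (c j)

/-- The space spanned by the shifts `x ↦ Φ_div(x, yⱼ) c` of the kernel, `c` tangent at `yⱼ`. -/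
def kernelSpace {n : ℕ} (φ : ℝ → ℝ) (y : Fin n → S2) : Submodule ℝ (S2 → E3) :=
  Submodule.span ℝ {f | ∃ (j : Fin n) (c : E3), inner ℝ (y j : E3) c = 0 ∧
    f = fun x : S2 => Matrix.toEuclideanLin (divKernel φ x (y j)) c}

/-- `s` is a div-free RBF interpolant of the data `u` at the nodes `y`. -/
def IsRBFInterpolant {n : ℕ} (φ : ℝ → ℝ) (y : Fin n → S2) (u : Fin n → E3) (s : S2 → E3) : Prop :=
  ∃ c : Fin n → E3, IsTangent y c ∧ s = rbfField φ y c ∧ ∀ i, s (y i) = u i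

/-- The Mercer expansion of the radial kernel `φ` on the sphere, with coefficients
`c_μ ε^(2μ)`:
`φ(‖x - y‖) = ∑_{μ ≥ 0} ∑'_{-μ ≤ ν ≤ μ} c_μ ε^(2μ) Y_μ^ν(y) Y_μ^ν(x)`. -/
def HasMercerExpansion (φ : ℝ → ℝ) (ε : ℝ) (c : ℕ → ℝ) : Prop :=
  ∀ x y : S2, HasSum
    (fun μ : ℕ => ∑ ν ∈ Finset.Icc (-(μ : ℤ)) (μ : ℤ),
      primeWeight ν * (c μ * ε ^ (2 * μ) * sphY μ ν y) * sphY μ ν x)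
    (φ ‖(x : E3) - (y : E3)‖)

end DivFreeRBF

end

/-!
In the basis `w_μ^ν` the field of a tangent coefficient list `a` is
`∑_μ c_μ ε^(2μ) ∑'_ν (∑ⱼ ⟪w_μ^ν(yⱼ), aⱼ⟫) w_μ^ν` (`hasSum_rbfField`). This is the Mercer expansion
differentiated termwise in both variables. The scalar expansion is only given on the sphere, but the
surface curl differentiates in tangent directions only, so each differentiation takes place along a
great circle (`hasSum_fderiv_of_hasSum_sphere`). Since `ε` may be taken as small as needed, bounds
of the form `K ^ μ` for the spherical harmonics and their gradients suffice; they follow from the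
Rodrigues formula, the normalising factor compensating the factorials
(`abs_sphY_le`, `norm_fderiv_sphY_le`, `norm_vsh_le`).

Unisolvency says that evaluation at the nodes is an isomorphism from the coefficients of degree at
most `μ₀` onto the tangent data. Its adjoint `a ↦ (∑ⱼ ⟪w_μ^ν(yⱼ), aⱼ⟫)_(μ,ν)` is then an isomorphism
as well, so the tangent lists have a basis dual to the harmonics (`Unisolvent.exists_dual_basis`).
Dividing the element of index `(μ, ν)` by the Mercer coefficient of `w_μ^ν` gives a list whose field
is `w_μ^ν` plus terms of degree `μ' > μ₀` with coefficients of order `ε ^ (2 (μ' - μ))`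
(`exists_basis_near_vsh`); a geometric series bounds the sum of these terms by a multiple of
`ε ^ 2`.

Interpolation at the nodes with fields that are uniformly close to the `w_μ^ν` is a small
perturbation of the unisolvent problem (`Unisolvent.exists_stability`). This gives injectivity of
the evaluation of kernel fields at the nodes, hence existence and uniqueness of the interpolant
because domain and target have the same dimension. It also gives convergence of the coefficients,
and with it uniform convergence of the interpolants.
-/

noncomputable section

namespace DivFreeRBF

/-! ### The surface curl as a tangential derivative -/

/-- The velocity `e_i × x` at `x` of the rotation about the `i`-th coordinate axis. -/
def rotVel (i : Fin 3) (x : E3) : E3 :=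
  WithLp.toLp 2 ((Pi.single i 1 : Fin 3 → ℝ) ⨯₃ (WithLp.ofLp x))

lemma inner_rotVel (i : Fin 3) (x : E3) : inner ℝ x (rotVel i x) = 0 := by
  fin_cases i <;>
    simp [rotVel, crossProduct, PiLp.inner_apply, Fin.sum_univ_three] <;> ring

lemma norm_rotVel_le (i : Fin 3) (x : E3) : ‖rotVel i x‖ ≤ ‖x‖ := by
  rw [EuclideanSpace.norm_eq, EuclideanSpace.norm_eq]
  apply Real.sqrt_le_sqrt
  fin_cases i <;>
    simp [rotVel, crossProduct, Fin.sum_univ_three] <;>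
      nlinarith [sq_nonneg (x 0), sq_nonneg (x 1), sq_nonneg (x 2)]

lemma rotc_apply (f : E3 → ℝ) (x : E3) (i : Fin 3) :
    rotc f x i = fderiv ℝ f x (rotVel i x) := by
  have h (g : E3) : (WithLp.ofLp x ⨯₃ WithLp.ofLp g) i = inner ℝ g (rotVel i x) := by
    fin_cases i <;>
      simp [rotVel, crossProduct, PiLp.inner_apply, Fin.sum_univ_three] <;> ring
  calc rotc f x i = inner ℝ (gradient f x) (rotVel i x) := h _
    _ = _ := by rw [gradient, InnerProductSpace.toDual_symm_apply]

lemma norm_le_sum_abs (v : E3) : ‖v‖ ≤ ∑ i, |v i| := by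
  rw [EuclideanSpace.norm_eq]
  apply Real.sqrt_le_iff.2
  refine ⟨Finset.sum_nonneg fun i _ => abs_nonneg _, ?_⟩
  simp only [Fin.sum_univ_three, Real.norm_eq_abs]
  nlinarith [abs_nonneg (v 0), abs_nonneg (v 1), abs_nonneg (v 2),
    mul_nonneg (abs_nonneg (v 0)) (abs_nonneg (v 1)),
    mul_nonneg (abs_nonneg (v 0)) (abs_nonneg (v 2)),
    mul_nonneg (abs_nonneg (v 1)) (abs_nonneg (v 2))]

lemma norm_rotc_le (f : E3 → ℝ) {x : E3} (hx : ‖x‖ = 1) :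
    ‖rotc f x‖ ≤ 3 * ‖fderiv ℝ f x‖ := by
  refine (norm_le_sum_abs _).trans ?_
  have h : ∀ i, |rotc f x i| ≤ ‖fderiv ℝ f x‖ := by
    intro i
    rw [rotc_apply]
    refine ((fderiv ℝ f x).le_opNorm _).trans ?_
    exact mul_le_of_le_one_right (norm_nonneg _) ((norm_rotVel_le i x).trans hx.le)
  calc ∑ i, |rotc f x i| ≤ ∑ _i : Fin 3, ‖fderiv ℝ f x‖ := Finset.sum_le_sum fun i _ => h i
    _ = _ := by simp

lemma inner_rotc (f : E3 → ℝ) (x : E3) : inner ℝ x (rotc f x) = 0 := by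
  simp [rotc, crossProduct, PiLp.inner_apply, Fin.sum_univ_three]
  ring

/-- Termwise differentiation on the sphere: a series that converges pointwise on the sphere, with
gradients summable uniformly on the sphere, may be differentiated termwise in every direction
tangent to the sphere. Only the values of the sum on the sphere enter, because the derivative is
taken along a great circle. -/
lemma hasSum_fderiv_of_hasSum_sphere {g : ℕ → E3 → ℝ} {f : E3 → ℝ} {u : ℕ → ℝ}
    (hg : ∀ μ, Differentiable ℝ (g μ)) (hu : Summable u)
    (hb : ∀ μ z, ‖z‖ = 1 → ‖fderiv ℝ (g μ) z‖ ≤ u μ)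
    (hs : ∀ z, ‖z‖ = 1 → HasSum (fun μ => g μ z) (f z))
    {x v : E3} (hx : ‖x‖ = 1) (hf : DifferentiableAt ℝ f x) (hv : inner ℝ x v = 0) :
    HasSum (fun μ => fderiv ℝ (g μ) x v) (fderiv ℝ f x v) := by
  -- For a unit direction the great circle below has unit speed.
  wlog hv1 : ‖v‖ = 1 generalizing v
  · rcases eq_or_ne v 0 with rfl | h0
    · simp
    · have hn : ‖v‖ ≠ 0 := norm_ne_zero_iff.2 h0
      have := this (v := ‖v‖⁻¹ • v) (by rw [inner_smul_right, hv, mul_zero])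
        (by rw [norm_smul, norm_inv, norm_norm, inv_mul_cancel₀ hn])
      simp only [map_smul] at this
      have h2 := this.const_smul ‖v‖
      simpa [smul_smul, hn] using h2
  set γ : ℝ → E3 := fun t => Real.cos t • x + Real.sin t • v with hγ
  set γ' : ℝ → E3 := fun t => (-Real.sin t) • x + Real.cos t • v with hγ'
  have key : ∀ a b : ℝ, a ^ 2 + b ^ 2 = 1 → ‖a • x + b • v‖ = 1 := by
    intro a b hab
    have h : ‖a • x + b • v‖ ^ 2 = 1 := by
      rw [norm_add_sq_real, inner_smul_left, inner_smul_right, hv, norm_smul, norm_smul, hx, hv1]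
      simp [hab]
    nlinarith [norm_nonneg (a • x + b • v)]
  have hγ1 : ∀ t, ‖γ t‖ = 1 := fun t => key _ _ (Real.cos_sq_add_sin_sq t)
  have hγ'1 : ∀ t, ‖γ' t‖ = 1 := fun t => key _ _ (by nlinarith [Real.cos_sq_add_sin_sq t])
  have hγd : ∀ t, HasDerivAt γ (γ' t) t := fun t =>
    ((Real.hasDerivAt_cos t).smul_const x).add ((Real.hasDerivAt_sin t).smul_const v)
  have hγ0 : γ 0 = x := by simp [hγ]
  have hγ'0 : γ' 0 = v := by simp [hγ']
  have hd : ∀ μ t, HasDerivAt (fun s => g μ (γ s)) (fderiv ℝ (g μ) (γ t) (γ' t)) t :=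
    fun μ t => ((hg μ (γ t)).hasFDerivAt).comp_hasDerivAt t (hγd t)
  have hdb : ∀ μ t, ‖fderiv ℝ (g μ) (γ t) (γ' t)‖ ≤ u μ := by
    intro μ t
    refine ((fderiv ℝ (g μ) (γ t)).le_opNorm _).trans ?_
    rw [hγ'1, mul_one]
    exact hb μ _ (hγ1 t)
  have h1 := hasDerivAt_tsum hu hd hdb (hs _ (hγ1 0)).summable 0
  have h2 : HasDerivAt (fun s => f (γ s)) (fderiv ℝ f x v) 0 := by
    have hf' : HasFDerivAt f (fderiv ℝ f x) (γ 0) := by rw [hγ0]; exact hf.hasFDerivAt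
    have := hf'.comp_hasDerivAt 0 (hγd 0)
    rwa [hγ'0] at this
  have h3 : (fun s => ∑' μ, g μ (γ s)) = fun s => f (γ s) :=
    funext fun s => (hs _ (hγ1 s)).tsum_eq
  rw [h3] at h1
  have h4 := h1.unique h2
  rw [← h4]
  have hsum : Summable fun μ => fderiv ℝ (g μ) (γ 0) (γ' 0) :=
    Summable.of_norm_bounded hu fun μ => hdb μ 0
  simpa [hγ0, hγ'0] using hsum.hasSum

/-! ### Exponential bounds for spherical harmonics -/

/-- Each of the monomials `X ^ (2 k)`, `k ≤ μ`, contributes a falling factorial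
`m! * (2 k).choose m ≤ m! * 4 ^ μ`, and the binomial coefficients add up to `2 ^ μ`. -/
lemma abs_eval_iterate_derivative_X_sq_sub_one_pow_le (μ m : ℕ) {z : ℝ} (hz : |z| ≤ 1) :
    |(Polynomial.derivative^[m] ((Polynomial.X ^ 2 - 1 : Polynomial ℝ) ^ μ)).eval z|
      ≤ m.factorial * 8 ^ μ := by
  have h : ((Polynomial.X ^ 2 - 1 : Polynomial ℝ) ^ μ) =
      ∑ k ∈ Finset.range (μ + 1), ((-1) ^ (μ - k) * (μ.choose k : ℝ)) • Polynomial.X ^ (2 * k) := by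
    rw [sub_eq_add_neg, add_pow]
    refine Finset.sum_congr rfl fun k _ => ?_
    rw [Polynomial.smul_eq_C_mul, pow_mul]
    simp
    ring
  rw [h, Polynomial.iterate_derivative_sum, Polynomial.eval_finsetSum]
  have hk : ∀ k ∈ Finset.range (μ + 1),
      |(Polynomial.derivative^[m] (((-1) ^ (μ - k) * (μ.choose k : ℝ)) •
        (Polynomial.X : Polynomial ℝ) ^ (2 * k))).eval z| ≤
      (μ.choose k : ℝ) * (m.factorial * 4 ^ μ) := by
    intro k hk
    have hkμ : k ≤ μ := Nat.lt_succ_iff.1 (Finset.mem_range.1 hk)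
    rw [Polynomial.iterate_derivative_smul, Polynomial.iterate_derivative_X_pow_eq_smul]
    simp only [Polynomial.eval_smul, Polynomial.eval_pow, Polynomial.eval_X, smul_eq_mul, abs_mul,
      abs_pow, abs_neg, abs_one, one_pow, one_mul, Nat.abs_cast]
    refine mul_le_mul_of_nonneg_left ?_ (Nat.cast_nonneg _)
    have h1 : ((2 * k).descFactorial m : ℝ) ≤ m.factorial * 4 ^ μ := by
      rw [Nat.descFactorial_eq_factorial_mul_choose]
      have : (2 * k).choose m ≤ 4 ^ μ := by
        calc (2 * k).choose m ≤ 2 ^ (2 * k) := Nat.choose_le_two_pow _ _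
          _ = 4 ^ k := by rw [pow_mul]; norm_num
          _ ≤ 4 ^ μ := Nat.pow_le_pow_right (by norm_num) hkμ
      exact_mod_cast Nat.mul_le_mul_left _ this
    calc _ ≤ ((2 * k).descFactorial m : ℝ) * 1 :=
          mul_le_mul_of_nonneg_left (pow_le_one₀ (abs_nonneg _) hz) (Nat.cast_nonneg _)
      _ ≤ _ := by rwa [mul_one]
  refine (Finset.abs_sum_le_sum_abs _ _).trans ((Finset.sum_le_sum hk).trans ?_)
  rw [← Finset.sum_mul]
  have : (∑ k ∈ Finset.range (μ + 1), (μ.choose k : ℝ)) = 2 ^ μ := by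
    exact_mod_cast Nat.sum_range_choose μ
  rw [this, show (8 : ℝ) = 2 * 4 by norm_num, mul_pow]
  exact le_of_eq (by ring)

lemma abs_eval_iterate_derivative_legendreP_le (μ m : ℕ) {z : ℝ} (hz : |z| ≤ 1) :
    |(Polynomial.derivative^[m] (legendreP μ)).eval z|
      ≤ (μ + m).factorial / μ.factorial * 4 ^ μ := by
  rw [legendreP, Polynomial.iterate_derivative_C_mul, ← Function.iterate_add_apply,
    Polynomial.eval_mul, Polynomial.eval_C, abs_mul, abs_of_nonneg (by positivity)]
  have h := abs_eval_iterate_derivative_X_sq_sub_one_pow_le μ (m + μ) hz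
  calc _ ≤ 1 / (2 ^ μ * (μ.factorial : ℝ)) * ((m + μ).factorial * 8 ^ μ) :=
        mul_le_mul_of_nonneg_left h (by positivity)
    _ = _ := by
        rw [show (8 : ℝ) = 2 * 4 by norm_num, mul_pow, add_comm m μ]
        field_simp

/-- The normalising factor absorbs the growth of the factorials in the derivatives of `P_μ`. -/
lemma sqrt_factorial_ratio_mul_le {μ m : ℕ} (hm : m ≤ μ) :
    √(((μ - m).factorial : ℝ) / ((μ + m).factorial : ℝ)) *
      ((μ + m).factorial / μ.factorial) ≤ 2 ^ μ := by
  have h1 : ((μ - m).factorial : ℝ) * (μ + m).factorial ≤ 4 ^ μ * (μ.factorial : ℝ) ^ 2 := by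
    have ha := Nat.add_choose_mul_factorial_mul_factorial (μ - m) (μ + m)
    have hb := Nat.add_choose_mul_factorial_mul_factorial μ μ
    have hc : μ - m + (μ + m) = μ + μ := by omega
    rw [hc] at ha
    have hd : 0 < (μ + μ).choose (μ + m) := Nat.choose_pos (by omega)
    have he : (μ + μ).choose μ ≤ 4 ^ μ := by
      calc _ ≤ 2 ^ (μ + μ) := Nat.choose_le_two_pow _ _
        _ = 4 ^ μ := by rw [← two_mul, pow_mul]; norm_num
    have hf : (μ - m).factorial * (μ + m).factorial ≤ 4 ^ μ * μ.factorial ^ 2 := by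
      calc _ ≤ (μ + μ).choose (μ + m) * ((μ - m).factorial * (μ + m).factorial) :=
            Nat.le_mul_of_pos_left _ hd
        _ = (μ + μ).choose μ * μ.factorial ^ 2 := by rw [← mul_assoc, ha, ← hb]; ring
        _ ≤ _ := Nat.mul_le_mul_right _ he
    exact_mod_cast hf
  refine (sq_le_sq₀ (by positivity) (by positivity)).1 ?_
  rw [mul_pow, Real.sq_sqrt (by positivity), ← pow_mul, mul_comm μ 2, pow_mul]
  norm_num
  rw [div_pow, div_mul_div_comm, div_le_iff₀ (by positivity)]
  have : (0 : ℝ) ≤ (μ + m).factorial := by positivity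
  nlinarith [mul_le_mul_of_nonneg_right h1 this]

/-- The complex coordinate `x + i y` of the equatorial plane. -/
def equatorial : E3 →L[ℝ] ℂ :=
  Complex.ofRealCLM.comp (EuclideanSpace.proj 0) +
    Complex.I • Complex.ofRealCLM.comp (EuclideanSpace.proj 1)

lemma equatorial_apply (x : E3) : equatorial x = (x 0 : ℂ) + (x 1 : ℂ) * Complex.I := by
  simp [equatorial, mul_comm]

lemma norm_equatorial_le (x : E3) : ‖equatorial x‖ ≤ ‖x‖ := by
  rw [equatorial_apply, Complex.norm_add_mul_I, EuclideanSpace.norm_eq]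
  apply Real.sqrt_le_sqrt
  simp [Fin.sum_univ_three]
  positivity

/-- The real or imaginary part, according to the sign of the order `ν`. -/
def azimuthalPart (ν : ℤ) : ℂ →L[ℝ] ℝ := if 0 ≤ ν then Complex.reCLM else Complex.imCLM

lemma abs_azimuthalPart_le (ν : ℤ) (w : ℂ) : |azimuthalPart ν w| ≤ ‖w‖ := by
  unfold azimuthalPart
  split_ifs
  · exact Complex.abs_re_le_norm w
  · exact Complex.abs_im_le_norm w

/-- The normalising factor of the spherical harmonic of degree `μ` and order `±m`. -/
def sphNorm (μ m : ℕ) : ℝ :=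
  √((2 * (μ : ℝ) + 1) / (4 * Real.pi)) *
    √(((μ - m).factorial : ℝ) / ((μ + m).factorial : ℝ))

lemma sphNorm_nonneg (μ m : ℕ) : 0 ≤ sphNorm μ m := by unfold sphNorm; positivity

lemma sphY_eq (μ : ℕ) (ν : ℤ) (x : E3) :
    sphY μ ν x = sphNorm μ ν.natAbs *
      (Polynomial.derivative^[ν.natAbs] (legendreP μ)).eval (x 2) *
      azimuthalPart ν (equatorial x ^ ν.natAbs) := by
  rw [sphY, sphNorm, equatorial_apply, azimuthalPart]
  split_ifs <;> rfl

lemma hasFDerivAt_sphY (μ : ℕ) (ν : ℤ) (x : E3) :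
    HasFDerivAt (sphY μ ν)
      ((sphNorm μ ν.natAbs * (Polynomial.derivative^[ν.natAbs] (legendreP μ)).eval (x 2)) •
        (azimuthalPart ν).comp ((ν.natAbs • equatorial x ^ (ν.natAbs - 1)) • equatorial) +
      azimuthalPart ν (equatorial x ^ ν.natAbs) • (sphNorm μ ν.natAbs •
        ((Polynomial.derivative^[ν.natAbs + 1] (legendreP μ)).eval (x 2) •
          (EuclideanSpace.proj 2 : E3 →L[ℝ] ℝ)))) x := by
  have h1 : HasFDerivAt (fun x : E3 => (Polynomial.derivative^[ν.natAbs] (legendreP μ)).eval (x 2))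
      ((Polynomial.derivative^[ν.natAbs + 1] (legendreP μ)).eval (x 2) •
          (EuclideanSpace.proj 2 : E3 →L[ℝ] ℝ)) x := by
    rw [Function.iterate_succ_apply']
    exact (Polynomial.hasDerivAt _ (x 2)).comp_hasFDerivAt x
      (EuclideanSpace.proj 2 : E3 →L[ℝ] ℝ).hasFDerivAt
  have h2 : HasFDerivAt (fun x : E3 => azimuthalPart ν (equatorial x ^ ν.natAbs))
      ((azimuthalPart ν).comp ((ν.natAbs • equatorial x ^ (ν.natAbs - 1)) • equatorial)) x :=
    (azimuthalPart ν).hasFDerivAt.comp x (equatorial.hasFDerivAt.pow ν.natAbs)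
  exact ((h1.const_mul (sphNorm μ ν.natAbs)).mul h2).congr_of_eventuallyEq
    (Eventually.of_forall fun x => sphY_eq μ ν x)

lemma differentiable_sphY (μ : ℕ) (ν : ℤ) : Differentiable ℝ (sphY μ ν) :=
  fun x => (hasFDerivAt_sphY μ ν x).differentiableAt

lemma two_mul_add_one_le_three_pow (μ : ℕ) : 2 * (μ : ℝ) + 1 ≤ 3 ^ μ := by
  have h := one_add_mul_le_pow (a := (2 : ℝ)) (by norm_num) μ
  norm_num at h
  linarith

lemma sphNorm_mul_factorial_ratio_le {μ m : ℕ} (hm : m ≤ μ) :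
    sphNorm μ m * ((μ + m).factorial / μ.factorial * 4 ^ μ) ≤ 24 ^ μ := by
  have h3 := two_mul_add_one_le_three_pow μ
  have h1 : √((2 * (μ : ℝ) + 1) / (4 * Real.pi)) ≤ 3 ^ μ := by
    refine Real.sqrt_le_iff.2 ⟨by positivity, ?_⟩
    calc (2 * (μ : ℝ) + 1) / (4 * Real.pi) ≤ 2 * (μ : ℝ) + 1 :=
          div_le_self (by positivity) (by linarith [Real.pi_gt_three])
      _ ≤ 3 ^ μ := h3
      _ ≤ (3 ^ μ) ^ 2 := le_self_pow₀ (one_le_pow₀ (by norm_num)) (by norm_num)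
  have h2 := sqrt_factorial_ratio_mul_le hm
  calc _ = √((2 * (μ : ℝ) + 1) / (4 * Real.pi)) *
        (√(((μ - m).factorial : ℝ) / ((μ + m).factorial : ℝ)) *
          ((μ + m).factorial / μ.factorial)) * 4 ^ μ := by rw [sphNorm]; ring
    _ ≤ 3 ^ μ * 2 ^ μ * 4 ^ μ := by gcongr
    _ = 24 ^ μ := by rw [← mul_pow, ← mul_pow]; norm_num

lemma abs_coord_le {x : E3} (hx : ‖x‖ = 1) (i : Fin 3) : |x i| ≤ 1 := by
  have := PiLp.norm_apply_le x i
  rwa [hx] at this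

lemma sphNorm_mul_abs_eval_le {μ m : ℕ} (hm : m ≤ μ) {z : ℝ} (hz : |z| ≤ 1) :
    sphNorm μ m * |(Polynomial.derivative^[m] (legendreP μ)).eval z| ≤ 24 ^ μ :=
  (mul_le_mul_of_nonneg_left (abs_eval_iterate_derivative_legendreP_le μ m hz)
    (sphNorm_nonneg μ m)).trans (sphNorm_mul_factorial_ratio_le hm)

lemma sphNorm_mul_abs_eval_succ_le {μ m : ℕ} (hm : m ≤ μ) {z : ℝ} (hz : |z| ≤ 1) :
    sphNorm μ m * |(Polynomial.derivative^[m + 1] (legendreP μ)).eval z| ≤ 72 ^ μ := by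
  have h := abs_eval_iterate_derivative_legendreP_le μ (m + 1) hz
  have h3 := two_mul_add_one_le_three_pow μ
  have hm' : (m : ℝ) ≤ μ := by exact_mod_cast hm
  have h0 := sphNorm_nonneg μ m
  calc _ ≤ sphNorm μ m * ((μ + (m + 1)).factorial / μ.factorial * 4 ^ μ) :=
        mul_le_mul_of_nonneg_left h h0
    _ = ((μ : ℝ) + m + 1) * (sphNorm μ m * ((μ + m).factorial / μ.factorial * 4 ^ μ)) := by
        rw [← add_assoc, Nat.factorial_succ]; push_cast; ring
    _ ≤ 3 ^ μ * 24 ^ μ := by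
        refine mul_le_mul (by linarith) (sphNorm_mul_factorial_ratio_le hm) (by positivity)
          (by positivity)
    _ = 72 ^ μ := by rw [← mul_pow]; norm_num

lemma abs_azimuthalPart_equatorial_pow_le (ν : ℤ) {x : E3} (hx : ‖x‖ = 1) (m : ℕ) :
    |azimuthalPart ν (equatorial x ^ m)| ≤ 1 := by
  refine (abs_azimuthalPart_le _ _).trans ?_
  rw [norm_pow]
  exact pow_le_one₀ (norm_nonneg _) ((norm_equatorial_le x).trans hx.le)

lemma abs_sphY_le {μ : ℕ} {ν : ℤ} (hν : ν.natAbs ≤ μ) {x : E3} (hx : ‖x‖ = 1) :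
    |sphY μ ν x| ≤ 144 ^ μ := by
  rw [sphY_eq, abs_mul, abs_mul, abs_of_nonneg (sphNorm_nonneg _ _)]
  calc _ ≤ (24 : ℝ) ^ μ * 1 :=
        mul_le_mul (sphNorm_mul_abs_eval_le hν (abs_coord_le hx 2))
          (abs_azimuthalPart_equatorial_pow_le ν hx _) (abs_nonneg _) (by positivity)
    _ ≤ 144 ^ μ := by rw [mul_one]; gcongr; norm_num

lemma sphY_zero_zero (x : E3) : sphY 0 0 x = sphNorm 0 0 := by
  rw [sphY_eq]; simp [legendreP, azimuthalPart]

lemma fderiv_sphY_zero_zero (x : E3) : fderiv ℝ (sphY 0 0) x = 0 := by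
  rw [funext sphY_zero_zero]; simp

/-- The derivatives of the zonal and of the azimuthal factor contribute at most `72 ^ μ` each, and
`2 * 72 ^ μ ≤ 144 ^ μ` for `μ ≥ 1`; for `μ = 0` the harmonic is constant. -/
lemma norm_fderiv_sphY_le {μ : ℕ} {ν : ℤ} (hν : ν.natAbs ≤ μ) {x : E3} (hx : ‖x‖ = 1) :
    ‖fderiv ℝ (sphY μ ν) x‖ ≤ 144 ^ μ := by
  rcases Nat.eq_zero_or_pos μ with rfl | hμ
  · obtain rfl : ν = 0 := by omega
    rw [fderiv_sphY_zero_zero]; simp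
  rw [(hasFDerivAt_sphY μ ν x).fderiv]
  refine (norm_add_le _ _).trans ?_
  have h0 := sphNorm_nonneg μ ν.natAbs
  have hA : ‖(azimuthalPart ν).comp
      ((ν.natAbs • equatorial x ^ (ν.natAbs - 1)) • equatorial)‖ ≤ 3 ^ μ := by
    refine ContinuousLinearMap.opNorm_le_bound _ (by positivity) fun v => ?_
    rw [ContinuousLinearMap.comp_apply, Real.norm_eq_abs]
    refine (abs_azimuthalPart_le _ _).trans ?_
    rw [smul_apply, smul_eq_mul, norm_mul, nsmul_eq_mul, norm_mul, norm_pow,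
      Complex.norm_natCast]
    have hm : (ν.natAbs : ℝ) ≤ 3 ^ μ := by
      have := two_mul_add_one_le_three_pow μ
      have h' : (ν.natAbs : ℝ) ≤ μ := by exact_mod_cast hν
      have h'' : (0 : ℝ) ≤ μ := Nat.cast_nonneg _
      linarith
    calc _ ≤ (3 : ℝ) ^ μ * 1 * ‖v‖ := by
          gcongr
          · exact pow_le_one₀ (norm_nonneg _) ((norm_equatorial_le x).trans hx.le)
          · exact norm_equatorial_le v
      _ = _ := by rw [mul_one]
  have hB : ‖(EuclideanSpace.proj 2 : E3 →L[ℝ] ℝ)‖ ≤ 1 :=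
    ContinuousLinearMap.opNorm_le_bound _ zero_le_one fun v => by
      simpa using PiLp.norm_apply_le v 2
  have h1 : ‖(sphNorm μ ν.natAbs *
      (Polynomial.derivative^[ν.natAbs] (legendreP μ)).eval (x 2)) •
        (azimuthalPart ν).comp ((ν.natAbs • equatorial x ^ (ν.natAbs - 1)) • equatorial)‖
      ≤ 24 ^ μ * 3 ^ μ := by
    rw [norm_smul, norm_mul, Real.norm_of_nonneg h0, Real.norm_eq_abs]
    exact mul_le_mul (sphNorm_mul_abs_eval_le hν (abs_coord_le hx 2)) hA (norm_nonneg _)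
      (by positivity)
  have h2 : ‖azimuthalPart ν (equatorial x ^ ν.natAbs) • (sphNorm μ ν.natAbs •
        ((Polynomial.derivative^[ν.natAbs + 1] (legendreP μ)).eval (x 2) •
          (EuclideanSpace.proj 2 : E3 →L[ℝ] ℝ)))‖ ≤ 1 * (72 ^ μ * 1) := by
    rw [norm_smul, norm_smul, norm_smul, Real.norm_of_nonneg h0, ← mul_assoc (sphNorm _ _)]
    refine mul_le_mul (abs_azimuthalPart_equatorial_pow_le ν hx _) ?_ (by positivity) zero_le_one
    exact mul_le_mul (sphNorm_mul_abs_eval_succ_le hν (abs_coord_le hx 2)) hB (norm_nonneg _)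
      (by positivity)
  calc _ ≤ (24 : ℝ) ^ μ * 3 ^ μ + 1 * (72 ^ μ * 1) := add_le_add h1 h2
    _ = 2 * 72 ^ μ := by rw [← mul_pow]; norm_num; ring
    _ ≤ 2 ^ μ * 72 ^ μ := by
        gcongr
        exact le_self_pow₀ (by norm_num) (by omega)
    _ = 144 ^ μ := by rw [← mul_pow]; norm_num

lemma vsh_zero_zero : vsh 0 0 = 0 := by
  funext x
  ext i
  rw [vsh, rotc_apply, fderiv_sphY_zero_zero]
  simp

lemma norm_vsh_le {μ : ℕ} {ν : ℤ} (hν : ν.natAbs ≤ μ) (x : S2) : ‖vsh μ ν x‖ ≤ 432 ^ μ := by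
  rcases Nat.eq_zero_or_pos μ with rfl | hμ
  · obtain rfl : ν = 0 := by omega
    simp [vsh_zero_zero]
  have hx : ‖(x : E3)‖ = 1 := norm_eq_of_mem_sphere x
  calc _ ≤ 3 * ‖fderiv ℝ (sphY μ ν) x‖ := norm_rotc_le _ hx
    _ ≤ 3 * 144 ^ μ := by gcongr; exact norm_fderiv_sphY_le hν hx
    _ ≤ 3 ^ μ * 144 ^ μ := by
        gcongr
        exact le_self_pow₀ (by norm_num) (by omega)
    _ = 432 ^ μ := by rw [← mul_pow]; norm_num

/-! ### The expansion of the kernel in vector spherical harmonics -/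

lemma natAbs_le_of_mem_Icc {μ : ℕ} {ν : ℤ} (h : ν ∈ Finset.Icc (-(μ : ℤ)) (μ : ℤ)) :
    ν.natAbs ≤ μ := by
  rw [Finset.mem_Icc] at h; omega

lemma card_Icc_neg_self (μ : ℕ) : (Finset.Icc (-(μ : ℤ)) (μ : ℤ)).card = 2 * μ + 1 := by
  rw [Int.card_Icc]; omega

/-- A sum over the orders of degree `μ` has `2 μ + 1 ≤ 3 ^ μ` terms. -/
lemma norm_sum_orders_le {E : Type*} [SeminormedAddCommGroup E] {μ : ℕ} {f : ℤ → E} {α : ℝ}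
    (h : ∀ ν : ℤ, ν.natAbs ≤ μ → ‖f ν‖ ≤ α) :
    ‖∑ ν ∈ Finset.Icc (-(μ : ℤ)) (μ : ℤ), f ν‖ ≤ 3 ^ μ * α := by
  have hα : 0 ≤ α := (norm_nonneg _).trans (h 0 (by simp))
  refine (norm_sum_le_of_le _ fun ν hν => h ν (natAbs_le_of_mem_Icc hν)).trans ?_
  rw [Finset.sum_const, card_Icc_neg_self, nsmul_eq_mul]
  push_cast
  exact mul_le_mul_of_nonneg_right (two_mul_add_one_le_three_pow μ) hα

lemma hasFDerivAt_sum_sphY (μ : ℕ) (a : ℤ → ℝ) (z : E3) :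
    HasFDerivAt (fun z => ∑ ν ∈ Finset.Icc (-(μ : ℤ)) (μ : ℤ), a ν * sphY μ ν z)
      (∑ ν ∈ Finset.Icc (-(μ : ℤ)) (μ : ℤ), a ν • fderiv ℝ (sphY μ ν) z) z :=
  HasFDerivAt.fun_sum fun ν _ => ((differentiable_sphY μ ν z).hasFDerivAt.const_mul (a ν))

/-- A scalar expansion in spherical harmonics with rapidly decreasing coefficients may be mapped
termwise by the surface curl. -/
lemma hasSum_rotc_of_hasSum_sphY {a : ℕ → ℤ → ℝ} {α : ℕ → ℝ} {f : E3 → ℝ}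
    (ha : ∀ (μ : ℕ) (ν : ℤ), ν.natAbs ≤ μ → |a μ ν| ≤ α μ)
    (hα : Summable fun μ => α μ * 432 ^ μ)
    (hf : ∀ z, ‖z‖ = 1 →
      HasSum (fun μ : ℕ => ∑ ν ∈ Finset.Icc (-(μ : ℤ)) (μ : ℤ), a μ ν * sphY μ ν z) (f z))
    {x : E3} (hx : ‖x‖ = 1) (hd : DifferentiableAt ℝ f x) (i : Fin 3) :
    HasSum (fun μ : ℕ => ∑ ν ∈ Finset.Icc (-(μ : ℤ)) (μ : ℤ), a μ ν * rotc (sphY μ ν) x i)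
      (rotc f x i) := by
  have key := hasSum_fderiv_of_hasSum_sphere
    (g := fun μ z => ∑ ν ∈ Finset.Icc (-(μ : ℤ)) (μ : ℤ), a μ ν * sphY μ ν z)
    (fun μ z => (hasFDerivAt_sum_sphY μ (a μ) z).differentiableAt) hα
    (fun μ z hz => by
      rw [(hasFDerivAt_sum_sphY μ (a μ) z).fderiv]
      have h1 : ∀ ν : ℤ, ν.natAbs ≤ μ → ‖a μ ν • fderiv ℝ (sphY μ ν) z‖ ≤ α μ * 144 ^ μ := by
        intro ν hν
        rw [norm_smul]
        exact mul_le_mul (ha μ ν hν) (norm_fderiv_sphY_le hν hz) (norm_nonneg _)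
          ((abs_nonneg _).trans (ha μ ν hν))
      refine (norm_sum_orders_le h1).trans (le_of_eq ?_)
      rw [show (432 : ℝ) = 3 * 144 by norm_num, mul_pow]; ring)
    hf hx hd (inner_rotVel i x)
  rw [rotc_apply]
  convert key using 2 with μ
  rw [(hasFDerivAt_sum_sphY μ (a μ) x).fderiv]
  simp [rotc_apply]

lemma abs_primeWeight_le (ν : ℤ) : |primeWeight ν| ≤ 1 := by
  unfold primeWeight; split_ifs <;> norm_num [abs_of_nonneg]

/-- For fixed `y`, each component of `L_y φ(‖x - y‖)` is differentiable in `x`: it is a first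
derivative, at `x - y`, of the `C²` function `φ(‖·‖)`. -/
lemma differentiable_rotc_kernel {ψ : ℝ → ℝ} (hψ : ContDiff ℝ 2 (fun x : E3 => ψ ‖x‖))
    (y : E3) (k : Fin 3) :
    Differentiable ℝ (fun x' : E3 => rotc (fun y' => ψ ‖x' - y'‖) y k) := by
  have h1 : ∀ x' : E3, rotc (fun y' => ψ ‖x' - y'‖) y k =
      -(fderiv ℝ (fun x : E3 => ψ ‖x‖) (x' - y) (rotVel k y)) := by
    intro x'
    have h := ((hψ.differentiable (by norm_num)) (x' - y)).hasFDerivAt.comp y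
      ((hasFDerivAt_id y).const_sub x')
    rw [rotc_apply]
    have h2 : fderiv ℝ (fun y' => ψ ‖x' - y'‖) y = _ := h.fderiv
    rw [h2]
    simp
  rw [funext h1]
  have h2 : Differentiable ℝ (fderiv ℝ (fun x : E3 => ψ ‖x‖)) :=
    (hψ.fderiv_right (m := 1) (by norm_num)).differentiable (by norm_num)
  have h3 : Differentiable ℝ fun x' : E3 => fderiv ℝ (fun x : E3 => ψ ‖x‖) (x' - y) :=
    h2.comp (differentiable_id.sub_const y)
  exact (h3.clm_apply (differentiable_const _)).neg

lemma hasSum_E3 {f : ℕ → E3} {s : E3} (h : ∀ i, HasSum (fun μ => f μ i) (s i)) : HasSum f s := by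
  have h1 : HasSum (fun μ => WithLp.ofLp (f μ)) (WithLp.ofLp s) := Pi.hasSum.2 h
  exact h1.mapL (EuclideanSpace.equiv (Fin 3) ℝ).symm.toContinuousLinearMap

/-- The Mercer expansion of the scalar kernel may be differentiated termwise in both variables,
which expands the matrix kernel in vector spherical harmonics. In the summability hypothesis one
factor `432 ^ μ` bounds the harmonics of degree `μ` in the variable that is held fixed, the other
one, `3 ^ μ * 144 ^ μ`, bounds the `2 μ + 1` gradients in the variable of differentiation. -/
lemma hasSum_divKernel {ψ : ℝ → ℝ} {ε : ℝ} {c : ℕ → ℝ}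
    (hψ : ContDiff ℝ 2 (fun x : E3 => ψ ‖x‖)) (hexp : HasMercerExpansion ψ ε c)
    (hc : Summable fun μ : ℕ => |c μ * ε ^ (2 * μ)| * 432 ^ μ * 432 ^ μ) (x y : S2) (v : E3) :
    HasSum (fun μ : ℕ => ∑ ν ∈ Finset.Icc (-(μ : ℤ)) (μ : ℤ),
      (primeWeight ν * (c μ * ε ^ (2 * μ)) * inner ℝ (vsh μ ν y) v) • vsh μ ν x)
      (Matrix.toEuclideanLin (divKernel ψ x y) v) := by
  have hy : ‖(y : E3)‖ = 1 := norm_eq_of_mem_sphere y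
  have hx : ‖(x : E3)‖ = 1 := norm_eq_of_mem_sphere x
  have hα (μ : ℕ) (ν : ℤ) (b K : ℝ) (hb : |b| ≤ K) :
      |primeWeight ν * (c μ * ε ^ (2 * μ)) * b| ≤ |c μ * ε ^ (2 * μ)| * K := by
    rw [abs_mul, abs_mul]
    calc _ ≤ 1 * |c μ * ε ^ (2 * μ)| * K := by
          gcongr
          exact abs_primeWeight_le ν
      _ = _ := by rw [one_mul]
  -- Differentiation in `y`.
  have h1 : ∀ (k : Fin 3) (z : E3), ‖z‖ = 1 → HasSum
      (fun μ : ℕ => ∑ ν ∈ Finset.Icc (-(μ : ℤ)) (μ : ℤ),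
        (primeWeight ν * (c μ * ε ^ (2 * μ)) * vsh μ ν y k) * sphY μ ν z)
      (rotc (fun y' => ψ ‖z - y'‖) y k) := by
    intro k z hz
    have h := hasSum_rotc_of_hasSum_sphY
      (a := fun μ ν => primeWeight ν * (c μ * ε ^ (2 * μ)) * sphY μ ν z)
      (α := fun μ => |c μ * ε ^ (2 * μ)| * 432 ^ μ) (f := fun y' => ψ ‖z - y'‖)
      (fun μ ν hν => hα μ ν _ _ ((abs_sphY_le hν hz).trans (by gcongr; norm_num))) hc
      (fun w hw => by
        refine (hexp ⟨z, by simpa using hz⟩ ⟨w, by simpa using hw⟩).congr_fun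
          fun μ => Finset.sum_congr rfl fun ν _ => ?_
        ring)
      hy
      (((hψ.differentiable (by norm_num)) (z - y)).comp (y : E3)
        ((differentiableAt_const z).sub differentiableAt_id)) k
    refine h.congr_fun fun μ => Finset.sum_congr rfl fun ν _ => ?_
    simp only [vsh]
    ring
  -- Differentiation in `x`.
  have h2 : ∀ (i k : Fin 3), HasSum
      (fun μ : ℕ => ∑ ν ∈ Finset.Icc (-(μ : ℤ)) (μ : ℤ),
        (primeWeight ν * (c μ * ε ^ (2 * μ)) * vsh μ ν y k) * vsh μ ν x i)
      (divKernel ψ x y i k) := by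
    intro i k
    exact hasSum_rotc_of_hasSum_sphY
      (a := fun μ ν => primeWeight ν * (c μ * ε ^ (2 * μ)) * vsh μ ν y k)
      (α := fun μ => |c μ * ε ^ (2 * μ)| * 432 ^ μ)
      (fun μ ν hν => hα μ ν _ _
        ((PiLp.norm_apply_le (vsh μ ν y) k).trans (norm_vsh_le hν y))) hc
      (fun z hz => h1 k z hz) hx (differentiable_rotc_kernel hψ _ k _) i
  refine hasSum_E3 fun i => ?_
  have h3 := hasSum_sum fun (k : Fin 3) (_ : k ∈ Finset.univ) => (h2 i k).mul_right (v k)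
  have h4 : Matrix.toEuclideanLin (divKernel ψ x y) v i = ∑ k, divKernel ψ x y i k * v k := by
    simp [Matrix.toLpLin_apply, Matrix.mulVec, dotProduct]
  rw [h4]
  refine h3.congr_fun fun μ => ?_
  simp only [WithLp.ofLp_sum, WithLp.ofLp_smul, Finset.sum_apply, Pi.smul_apply, smul_eq_mul,
    Finset.sum_mul]
  rw [Finset.sum_comm]
  refine Finset.sum_congr rfl fun ν _ => ?_
  simp only [PiLp.inner_apply, Fin.sum_univ_three, RCLike.inner_apply, conj_trivial]
  ring

/-- The pairing `∑ⱼ ⟪w(yⱼ), aⱼ⟫` of a vector spherical harmonic with vectors at the nodes. -/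
def nodePairing {n : ℕ} (y : Fin n → S2) (μ : ℕ) (ν : ℤ) (a : Fin n → E3) : ℝ :=
  ∑ j, inner ℝ (vsh μ ν (y j)) (a j)

lemma abs_nodePairing_le {n : ℕ} (y : Fin n → S2) {μ : ℕ} {ν : ℤ} (hν : ν.natAbs ≤ μ)
    (a : Fin n → E3) : |nodePairing y μ ν a| ≤ 432 ^ μ * ∑ j, ‖a j‖ := by
  rw [nodePairing, Finset.mul_sum]
  refine (Finset.abs_sum_le_sum_abs _ _).trans (Finset.sum_le_sum fun j _ => ?_)
  exact (abs_real_inner_le_norm _ _).trans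
    (mul_le_mul_of_nonneg_right (norm_vsh_le hν _) (norm_nonneg _))

lemma hasSum_rbfField {n : ℕ} {ψ : ℝ → ℝ} {ε : ℝ} {c : ℕ → ℝ}
    (hψ : ContDiff ℝ 2 (fun x : E3 => ψ ‖x‖)) (hexp : HasMercerExpansion ψ ε c)
    (hc : Summable fun μ : ℕ => |c μ * ε ^ (2 * μ)| * 432 ^ μ * 432 ^ μ)
    (y : Fin n → S2) (a : Fin n → E3) (x : S2) :
    HasSum (fun μ : ℕ => ∑ ν ∈ Finset.Icc (-(μ : ℤ)) (μ : ℤ),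
      (primeWeight ν * (c μ * ε ^ (2 * μ)) * nodePairing y μ ν a) • vsh μ ν x)
      (rbfField ψ y a x) := by
  have h := hasSum_sum fun (j : Fin n) (_ : j ∈ Finset.univ) =>
    hasSum_divKernel hψ hexp hc x (y j) (a j)
  refine h.congr_fun fun μ => ?_
  rw [Finset.sum_comm]
  refine Finset.sum_congr rfl fun ν _ => ?_
  rw [nodePairing, Finset.mul_sum, Finset.sum_smul]

/-! ### Linear algebra at the nodes -/

/-- The space of lists of vectors tangent to the sphere at the nodes. -/
def tangentSpace {n : ℕ} (y : Fin n → S2) : Submodule ℝ (Fin n → E3) where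
  carrier := {u | IsTangent y u}
  add_mem' := fun ha hb j => by rw [Pi.add_apply, inner_add_right, ha j, hb j, add_zero]
  zero_mem' := fun j => by simp
  smul_mem' := fun t u hu j => by rw [Pi.smul_apply, inner_smul_right, hu j, mul_zero]

/-- Evaluation at the nodes of the field with given coefficients in the basis `w_μ^ν`. -/
def vshEval {n : ℕ} (μ₀ : ℕ) (y : Fin n → S2) : (vshIndex μ₀ → ℝ) →ₗ[ℝ] tangentSpace y where
  toFun a := ⟨fun i => ∑ k, a k • vsh k.1.1 k.1.2 (y i), fun i => by
    rw [inner_sum]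
    exact Finset.sum_eq_zero fun k _ => by rw [inner_smul_right, vsh, inner_rotc, mul_zero]⟩
  map_add' a b := by
    ext1; funext i
    simp [add_smul, Finset.sum_add_distrib]
  map_smul' t a := by
    ext1; funext i
    simp [mul_smul, Finset.smul_sum]

lemma vshEval_apply {n : ℕ} (μ₀ : ℕ) (y : Fin n → S2) (a : vshIndex μ₀ → ℝ) (i : Fin n) :
    (vshEval μ₀ y a : Fin n → E3) i = ∑ k, a k • vsh k.1.1 k.1.2 (y i) := rfl

lemma Unisolvent.bijective_vshEval {n μ₀ : ℕ} {y : Fin n → S2} (hy : Unisolvent μ₀ y) :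
    Function.Bijective (vshEval μ₀ y) := by
  refine (Function.bijective_iff_existsUnique _).2 fun u => ?_
  obtain ⟨a, ha, hu⟩ := hy u u.2
  exact ⟨a, Subtype.ext (funext ha), fun b hb => hu b fun i => congrFun (congrArg Subtype.val hb) i⟩

/-- Unisolvency as a linear equivalence between coefficients and tangent data. -/
def Unisolvent.equiv {n μ₀ : ℕ} {y : Fin n → S2} (hy : Unisolvent μ₀ y) :
    (vshIndex μ₀ → ℝ) ≃ₗ[ℝ] tangentSpace y :=
  LinearEquiv.ofBijective (vshEval μ₀ y) hy.bijective_vshEval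

/-- The adjoint of `vshEval`. -/
def vshPairing {n : ℕ} (μ₀ : ℕ) (y : Fin n → S2) : tangentSpace y →ₗ[ℝ] (vshIndex μ₀ → ℝ) where
  toFun a k := nodePairing y k.1.1 k.1.2 a
  map_add' a b := by
    funext k
    simp [nodePairing, inner_add_right, Finset.sum_add_distrib]
  map_smul' t a := by
    funext k
    simp [nodePairing, inner_smul_right, Finset.mul_sum]

/-- The adjoint is injective because `vshEval` is onto. -/
lemma Unisolvent.injective_vshPairing {n μ₀ : ℕ} {y : Fin n → S2} (hy : Unisolvent μ₀ y) :
    Function.Injective (vshPairing μ₀ y) := by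
  refine (injective_iff_map_eq_zero _).2 fun c hc => ?_
  obtain ⟨a, ha⟩ := hy.bijective_vshEval.2 c
  have h : ∑ j, inner ℝ ((c : Fin n → E3) j) ((c : Fin n → E3) j) = 0 := by
    calc _ = ∑ j, inner ℝ ((vshEval μ₀ y a : Fin n → E3) j) ((c : Fin n → E3) j) := by rw [ha]
      _ = ∑ k, a k * nodePairing y k.1.1 k.1.2 c := by
        simp only [vshEval_apply, sum_inner, inner_smul_left, nodePairing, Finset.mul_sum]
        rw [Finset.sum_comm]
        rfl
      _ = 0 := Finset.sum_eq_zero fun k _ => by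
        rw [show nodePairing y k.1.1 k.1.2 c = 0 from congrFun hc k, mul_zero]
  rw [Finset.sum_eq_zero_iff_of_nonneg fun j _ => real_inner_self_nonneg] at h
  ext1; funext j
  exact inner_self_eq_zero.1 (h j (Finset.mem_univ j))

/-- The tangent lists have a basis dual to the vector spherical harmonics of degree at
most `μ₀`. -/
lemma Unisolvent.exists_dual_basis {n μ₀ : ℕ} {y : Fin n → S2} (hy : Unisolvent μ₀ y) :
    ∃ β : Module.Basis (vshIndex μ₀) ℝ (tangentSpace y),
      ∀ k k' : vshIndex μ₀, nodePairing y k'.1.1 k'.1.2 (β k) = if k' = k then 1 else 0 := by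
  let B := LinearMap.linearEquivOfInjective (vshPairing μ₀ y) hy.injective_vshPairing
    hy.equiv.finrank_eq.symm
  refine ⟨(Pi.basisFun ℝ (vshIndex μ₀)).map B.symm, fun k k' => ?_⟩
  have h : vshPairing μ₀ y (B.symm (Pi.single k 1)) = Pi.single k 1 := B.apply_symm_apply _
  have h' := congrFun h k'
  rw [Pi.single_apply] at h'
  rw [Module.Basis.map_apply, Pi.basisFun_apply]
  exact h'

/-- Coefficients are controlled by the values at the nodes. -/
lemma Unisolvent.exists_bound {n μ₀ : ℕ} {y : Fin n → S2} (hy : Unisolvent μ₀ y) :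
    ∃ K : ℝ, 0 ≤ K ∧ ∀ (a : vshIndex μ₀ → ℝ) (τ : ℝ), 0 ≤ τ →
      (∀ i, ‖∑ k, a k • vsh k.1.1 k.1.2 (y i)‖ ≤ τ) → ∑ k, |a k| ≤ K * τ := by
  let S := LinearMap.toContinuousLinearMap (hy.equiv.symm : tangentSpace y →ₗ[ℝ] vshIndex μ₀ → ℝ)
  refine ⟨Fintype.card (vshIndex μ₀) * ‖S‖, by positivity, fun a τ hτ h => ?_⟩
  have h1 : ‖vshEval μ₀ y a‖ ≤ τ := (pi_norm_le_iff_of_nonneg hτ).2 h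
  have h2 : S (vshEval μ₀ y a) = a := hy.equiv.symm_apply_apply a
  have h3 : ‖a‖ ≤ ‖S‖ * τ := by
    calc ‖a‖ = ‖S (vshEval μ₀ y a)‖ := by rw [h2]
      _ ≤ ‖S‖ * ‖vshEval μ₀ y a‖ := S.le_opNorm _
      _ ≤ _ := by gcongr
  calc ∑ k, |a k| ≤ ∑ _k : vshIndex μ₀, ‖S‖ * τ :=
        Finset.sum_le_sum fun k _ => (norm_le_pi_norm a k).trans h3
    _ = _ := by simp [mul_assoc]

lemma norm_sum_smul_le {ι : Type*} [Fintype ι] {E : Type*} [SeminormedAddCommGroup E]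
    [NormedSpace ℝ E] (a : ι → ℝ) {f : ι → E} {η : ℝ} (h : ∀ k, ‖f k‖ ≤ η) :
    ‖∑ k, a k • f k‖ ≤ η * ∑ k, |a k| := by
  rw [Finset.mul_sum]
  refine norm_sum_le_of_le _ fun k _ => ?_
  rw [norm_smul, Real.norm_eq_abs, mul_comm]
  exact mul_le_mul_of_nonneg_right (h k) (abs_nonneg _)

/-- Stability of the interpolation problem: if the fields `b k` are uniformly `η`-close to the
vector spherical harmonics, then interpolation of the same data in the two systems yields
coefficients that differ by `O(η)`. For zero data this says that the `b k` are linearly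
independent at the nodes. -/
lemma Unisolvent.exists_stability {n μ₀ : ℕ} {y : Fin n → S2} (hy : Unisolvent μ₀ y) :
    ∃ K : ℝ, 0 ≤ K ∧ ∀ (η : ℝ), 0 ≤ η → K * η ≤ 1 / 2 → ∀ b : vshIndex μ₀ → S2 → E3,
      (∀ k x, ‖b k x - vsh k.1.1 k.1.2 x‖ ≤ η) → ∀ a a₀ : vshIndex μ₀ → ℝ,
      (∀ i, ∑ k, a k • b k (y i) = ∑ k, a₀ k • vsh k.1.1 k.1.2 (y i)) →
      ∑ k, |a k - a₀ k| ≤ 2 * (K * η) * ∑ k, |a₀ k| := by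
  obtain ⟨K, hK, h⟩ := hy.exists_bound
  refine ⟨K, hK, fun η hη hKη b hb a a₀ hab => ?_⟩
  have h1 : ∑ k, |a k - a₀ k| ≤ K * (η * ∑ k, |a k|) := by
    refine h _ _ (by positivity) fun i => ?_
    have h2 : ∑ k, (a k - a₀ k) • vsh k.1.1 k.1.2 (y i) =
        -∑ k, a k • (b k (y i) - vsh k.1.1 k.1.2 (y i)) := by
      simp only [sub_smul, smul_sub, Finset.sum_sub_distrib, hab i]
      abel
    rw [h2, norm_neg]
    exact norm_sum_smul_le a fun k => hb k (y i)
  have h3 : ∑ k, |a k| ≤ ∑ k, |a k - a₀ k| + ∑ k, |a₀ k| := by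
    rw [← Finset.sum_add_distrib]
    refine Finset.sum_le_sum fun k _ => ?_
    have := abs_add_le (a k - a₀ k) (a₀ k)
    rwa [sub_add_cancel] at this
  have h4 : 0 ≤ ∑ k, |a k - a₀ k| := by positivity
  have h5 : 0 ≤ K * η := by positivity
  nlinarith [mul_le_mul_of_nonneg_left h3 h5, mul_le_mul_of_nonneg_right hKη h4]

/-! ### Kernel fields -/

lemma toEuclideanLin_divKernel (ψ : ℝ → ℝ) (x y v : E3) :
    Matrix.toEuclideanLin (divKernel ψ x y) v =
      ∑ k, v k • rotc (fun x' => rotc (fun y' => ψ ‖x' - y'‖) y k) x := by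
  ext i
  simp [Matrix.toLpLin_apply, Matrix.mulVec, dotProduct, divKernel, mul_comm]

lemma inner_rbfField {n : ℕ} (ψ : ℝ → ℝ) (y : Fin n → S2) (a : Fin n → E3) (x : S2) :
    inner ℝ (x : E3) (rbfField ψ y a x) = 0 := by
  simp only [rbfField, toEuclideanLin_divKernel, inner_sum, inner_smul_right, inner_rotc,
    mul_zero, Finset.sum_const_zero]

/-- The kernel field as a linear function of its coefficient list. -/
def rbfLin {n : ℕ} (ψ : ℝ → ℝ) (y : Fin n → S2) : tangentSpace y →ₗ[ℝ] (S2 → E3) where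
  toFun a := rbfField ψ y a
  map_add' a b := by
    funext x
    simp [rbfField, Finset.sum_add_distrib]
  map_smul' t a := by
    funext x
    simp [rbfField, Finset.smul_sum]

lemma rbfLin_apply {n : ℕ} (ψ : ℝ → ℝ) (y : Fin n → S2) (a : tangentSpace y) :
    rbfLin ψ y a = rbfField ψ y a := rfl

lemma range_rbfLin {n : ℕ} (ψ : ℝ → ℝ) (y : Fin n → S2) :
    LinearMap.range (rbfLin ψ y) = kernelSpace ψ y := by
  apply le_antisymm
  · rintro _ ⟨a, rfl⟩
    have h : rbfLin ψ y a =
        ∑ j, fun x : S2 => Matrix.toEuclideanLin (divKernel ψ x (y j)) ((a : Fin n → E3) j) := by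
      funext x
      rw [Finset.sum_apply]
      rfl
    rw [h]
    exact Submodule.sum_mem _ fun j _ => Submodule.subset_span ⟨j, _, a.2 j, rfl⟩
  · refine Submodule.span_le.2 ?_
    rintro _ ⟨j, v, hv, rfl⟩
    refine ⟨⟨Pi.single j v, fun i => ?_⟩, ?_⟩
    · rcases eq_or_ne i j with rfl | hij
      · simpa using hv
      · simp [hij]
    · funext x
      rw [rbfLin_apply, rbfField, Finset.sum_eq_single j]
      · simp
      · intro i _ hij
        simp [hij]
      · simp

/-- Evaluation of kernel fields at the nodes, as an endomorphism of the tangent lists: from the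
coefficient list of the field to its values. -/
def rbfEval {n : ℕ} (ψ : ℝ → ℝ) (y : Fin n → S2) : tangentSpace y →ₗ[ℝ] tangentSpace y where
  toFun a := ⟨fun i => rbfField ψ y a (y i), fun i => inner_rbfField ψ y a (y i)⟩
  map_add' a b := by
    ext1; funext i
    exact congrFun ((rbfLin ψ y).map_add a b) (y i)
  map_smul' t a := by
    ext1; funext i
    exact congrFun ((rbfLin ψ y).map_smul t a) (y i)

lemma existsUnique_interpolant_of_injective {n : ℕ} {ψ : ℝ → ℝ} {y : Fin n → S2}
    (h : Function.Injective (rbfEval ψ y)) {u : Fin n → E3} (hu : IsTangent y u) :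
    ∃! a : Fin n → E3, IsTangent y a ∧ ∀ i, rbfField ψ y a (y i) = u i := by
  obtain ⟨a, ha⟩ := LinearMap.surjective_of_injective h ⟨u, hu⟩
  refine ⟨a, ⟨a.2, fun i => congrFun (congrArg Subtype.val ha) i⟩, ?_⟩
  rintro b ⟨hb, hbu⟩
  have : rbfEval ψ y ⟨b, hb⟩ = rbfEval ψ y a := by
    rw [ha]; exact Subtype.ext (funext hbu)
  exact congrArg Subtype.val (h this)

lemma rbfLin_injective_of_rbfEval {n : ℕ} {ψ : ℝ → ℝ} {y : Fin n → S2}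
    (h : Function.Injective (rbfEval ψ y)) : Function.Injective (rbfLin ψ y) := fun _ _ hab =>
  h (Subtype.ext (funext fun i => congrFun hab (y i)))

/-! ### A basis of the kernel space close to the vector spherical harmonics -/

lemma mem_vshIndex {μ₀ : ℕ} {k : Σ _ : ℕ, ℤ} :
    k ∈ vshIndex μ₀ ↔ (1 ≤ k.1 ∧ k.1 ≤ μ₀) ∧ k.2.natAbs ≤ k.1 := by
  simp only [vshIndex, Finset.mem_sigma, Finset.mem_Icc]
  omega

/-- If the coefficient list `a` is dual, up to the Mercer coefficients, to the harmonic of index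
`k`, then the field of `a` is that harmonic plus a tail of degree greater than `μ₀`. -/
lemma hasSum_rbfField_sub_vsh {n μ₀ : ℕ} {ψ : ℝ → ℝ} {ε : ℝ} {c : ℕ → ℝ}
    (hψ : ContDiff ℝ 2 (fun x : E3 => ψ ‖x‖)) (hexp : HasMercerExpansion ψ ε c)
    (hc : Summable fun μ : ℕ => |c μ * ε ^ (2 * μ)| * 432 ^ μ * 432 ^ μ)
    (y : Fin n → S2) (a : Fin n → E3) (k : vshIndex μ₀)
    (ha : ∀ k' : vshIndex μ₀, primeWeight k'.1.2 * (c k'.1.1 * ε ^ (2 * k'.1.1)) *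
      nodePairing y k'.1.1 k'.1.2 a = if k' = k then 1 else 0) (x : S2) :
    HasSum (fun j : ℕ => ∑ ν ∈ Finset.Icc (-((μ₀ + 1 + j : ℕ) : ℤ)) ((μ₀ + 1 + j : ℕ) : ℤ),
      (primeWeight ν * (c (μ₀ + 1 + j) * ε ^ (2 * (μ₀ + 1 + j))) *
        nodePairing y (μ₀ + 1 + j) ν a) • vsh (μ₀ + 1 + j) ν x)
      (rbfField ψ y a x - vsh k.1.1 k.1.2 x) := by
  have h := (hasSum_nat_add_iff' (μ₀ + 1)).2 (hasSum_rbfField hψ hexp hc y a x)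
  have hk := mem_vshIndex.1 k.2
  -- Up to degree `μ₀` only the term of index `k` survives.
  have hhead : ∑ μ ∈ Finset.range (μ₀ + 1), ∑ ν ∈ Finset.Icc (-(μ : ℤ)) (μ : ℤ),
      (primeWeight ν * (c μ * ε ^ (2 * μ)) * nodePairing y μ ν a) • vsh μ ν x =
      vsh k.1.1 k.1.2 x := by
    have h0 : ∀ μ ∈ Finset.range (μ₀ + 1), ∀ ν ∈ Finset.Icc (-(μ : ℤ)) (μ : ℤ),
        (⟨μ, ν⟩ : Σ _ : ℕ, ℤ) ≠ k.1 →
        (primeWeight ν * (c μ * ε ^ (2 * μ)) * nodePairing y μ ν a) • vsh μ ν x = 0 := by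
      intro μ hμ ν hν hne
      have hν' := natAbs_le_of_mem_Icc hν
      rcases Nat.eq_zero_or_pos μ with rfl | hpos
      · obtain rfl : ν = 0 := by omega
        rw [vsh_zero_zero, Pi.zero_apply, smul_zero]
      · have hmem : (⟨μ, ν⟩ : Σ _ : ℕ, ℤ) ∈ vshIndex μ₀ :=
          mem_vshIndex.2 ⟨⟨hpos, Nat.lt_succ_iff.1 (Finset.mem_range.1 hμ)⟩, hν'⟩
        have := ha ⟨_, hmem⟩
        rw [if_neg fun h => hne (congrArg Subtype.val h)] at this
        rw [this, zero_smul]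
    have hmr : k.1.1 ∈ Finset.range (μ₀ + 1) := Finset.mem_range.2 (by omega)
    have hmi : k.1.2 ∈ Finset.Icc (-(k.1.1 : ℤ)) (k.1.1 : ℤ) := Finset.mem_Icc.2 (by omega)
    rw [Finset.sum_eq_single_of_mem _ hmr, Finset.sum_eq_single_of_mem _ hmi]
    · have := ha k
      rw [if_pos rfl] at this
      rw [this, one_smul]
    · intro ν hν hne
      exact h0 _ hmr ν hν fun h => hne (by rw [← h])
    · intro μ hμ hne
      exact Finset.sum_eq_zero fun ν hν => h0 μ hμ ν hν fun h => hne (by rw [← h])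
  rw [hhead] at h
  refine h.congr_fun fun j => ?_
  rw [add_comm (μ₀ + 1) j]

/-- A tail of vector spherical harmonics of degree greater than `μ₀`, with coefficients bounded by
`M κ ^ μ' ε ^ (2 (μ' - μ))` where `μ ≤ μ₀`, is `O(ε ^ 2)`. -/
lemma norm_tail_le {μ₀ m : ℕ} (hm : m ≤ μ₀) {M κ ε : ℝ} (hM : 0 ≤ M) (hκ : 0 ≤ κ) (hε : 0 ≤ ε)
    (hε1 : ε ≤ 1) (hκε : 1296 * κ * ε ^ 2 ≤ 1 / 2) {r : ℕ → ℤ → ℝ}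
    (hr : ∀ μ : ℕ, μ₀ < μ → ∀ ν : ℤ, ν.natAbs ≤ μ → |r μ ν| ≤ M * κ ^ μ * ε ^ (2 * (μ - m)))
    {x : S2} {s : E3} (hs : HasSum (fun j : ℕ =>
      ∑ ν ∈ Finset.Icc (-((μ₀ + 1 + j : ℕ) : ℤ)) ((μ₀ + 1 + j : ℕ) : ℤ),
        r (μ₀ + 1 + j) ν • vsh (μ₀ + 1 + j) ν x) s) :
    ‖s‖ ≤ 2 * M * (1296 * κ) ^ (μ₀ + 1) * ε ^ 2 := by
  set q := 1296 * κ with hq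
  have hq0 : 0 ≤ q := by positivity
  have hgeo := (hasSum_geometric_of_lt_one (r := q * ε ^ 2) (by positivity)
    (by linarith)).mul_left (M * q ^ (μ₀ + 1) * ε ^ 2)
  have hterm : ∀ j : ℕ, ‖∑ ν ∈ Finset.Icc (-((μ₀ + 1 + j : ℕ) : ℤ)) ((μ₀ + 1 + j : ℕ) : ℤ),
        r (μ₀ + 1 + j) ν • vsh (μ₀ + 1 + j) ν x‖ ≤
      M * q ^ (μ₀ + 1) * ε ^ 2 * (q * ε ^ 2) ^ j := by
    intro j
    set μ := μ₀ + 1 + j with hμ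
    have h1 : ∀ ν : ℤ, ν.natAbs ≤ μ → ‖r μ ν • vsh μ ν x‖ ≤
        M * κ ^ μ * ε ^ (2 * (1 + j)) * 432 ^ μ := by
      intro ν hν
      rw [norm_smul]
      refine mul_le_mul ((hr μ (by omega) ν hν).trans ?_) (norm_vsh_le hν x) (norm_nonneg _)
        (by positivity)
      exact mul_le_mul_of_nonneg_left (pow_le_pow_of_le_one hε hε1 (by omega)) (by positivity)
    refine (norm_sum_orders_le h1).trans (le_of_eq ?_)
    have h2 : q ^ μ = 3 ^ μ * κ ^ μ * 432 ^ μ := by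
      rw [← mul_pow, ← mul_pow, hq]; congr 1; ring
    calc _ = M * q ^ μ * ε ^ (2 * (1 + j)) := by rw [h2]; ring
      _ = _ := by rw [hμ, pow_add q, pow_mul, pow_add, mul_pow]; ring
  have h := tsum_of_norm_bounded hgeo hterm
  rw [hs.tsum_eq] at h
  refine h.trans ?_
  have h2 : (1 - q * ε ^ 2)⁻¹ ≤ 2 := by
    rw [inv_le_comm₀ (by linarith) (by norm_num)]; linarith
  calc _ ≤ M * q ^ (μ₀ + 1) * ε ^ 2 * 2 := by gcongr
    _ = _ := by ring

lemma eventually_mul_sq_le (X : ℝ) {t : ℝ} (ht : 0 < t) :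
    ∀ᶠ ε in 𝓝[>] (0 : ℝ), X * ε ^ 2 ≤ t := by
  have h : Tendsto (fun ε : ℝ => X * ε ^ 2) (𝓝[>] 0) (𝓝 0) := by
    have h1 : Continuous fun ε : ℝ => X * ε ^ 2 := by fun_prop
    have h2 := h1.tendsto 0
    rw [show X * (0 : ℝ) ^ 2 = 0 by ring] at h2
    exact h2.mono_left nhdsWithin_le_nhds
  exact (h.eventually (gt_mem_nhds ht)).mono fun ε h => h.le

lemma half_le_primeWeight (ν : ℤ) : 1 / 2 ≤ primeWeight ν := by
  unfold primeWeight; split_ifs <;> norm_num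

lemma summable_mercer_coeff {c : ℕ → ℝ} {C ρ ε : ℝ} (hρ : 0 ≤ ρ)
    (hc : ∀ μ : ℕ, 1 ≤ μ → |c μ| ≤ C * ρ ^ μ) (hε : 432 ^ 2 * ρ * ε ^ 2 ≤ 1 / 2) :
    Summable fun μ : ℕ => |c μ * ε ^ (2 * μ)| * 432 ^ μ * 432 ^ μ := by
  refine (summable_nat_add_iff 1).1 ?_
  have hg : Summable fun μ : ℕ => C * (432 ^ 2 * ρ * ε ^ 2) ^ (μ + 1) :=
    ((summable_nat_add_iff 1).2
      (summable_geometric_of_lt_one (by positivity) (by linarith))).mul_left C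
  refine Summable.of_nonneg_of_le (fun μ => by positivity) (fun μ => ?_) hg
  have he : 0 ≤ ε ^ (2 * (μ + 1)) := by rw [pow_mul]; positivity
  calc |c (μ + 1) * ε ^ (2 * (μ + 1))| * 432 ^ (μ + 1) * 432 ^ (μ + 1)
      = |c (μ + 1)| * (ε ^ (2 * (μ + 1)) * 432 ^ (μ + 1) * 432 ^ (μ + 1)) := by
        rw [abs_mul, abs_of_nonneg he]; ring
    _ ≤ C * ρ ^ (μ + 1) * (ε ^ (2 * (μ + 1)) * 432 ^ (μ + 1) * 432 ^ (μ + 1)) := by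
        gcongr
        exact hc _ (by omega)
    _ = C * (432 ^ 2 * ρ * ε ^ 2) ^ (μ + 1) := by
        generalize μ + 1 = k
        rw [mul_pow, mul_pow, ← pow_mul, ← pow_mul]; ring

/-- The bound for the coefficients of the tails, from `|c_μ| ≤ C ρ ^ μ` for the degree `μ` of the
tail and a lower bound for the Mercer coefficient `D` of the leading term. -/
lemma abs_tail_coeff_le {w cμ D p C ρ δ G ε : ℝ} {μ m : ℕ} (hm : m ≤ μ) (hw : |w| ≤ 1)
    (hc : |cμ| ≤ C * ρ ^ μ) (hδ : 0 < δ) (hε : 0 < ε) (hD : δ / 2 * ε ^ (2 * m) ≤ |D|)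
    (hp : |p| ≤ 432 ^ μ * G) :
    |w * (cμ * ε ^ (2 * μ)) * (D⁻¹ * p)| ≤
      2 * C * G / δ * (432 * ρ) ^ μ * ε ^ (2 * (μ - m)) := by
  have h2 : |D|⁻¹ ≤ (δ / 2 * ε ^ (2 * m))⁻¹ := inv_anti₀ (by positivity) hD
  have h3 : ε ^ (2 * μ) = ε ^ (2 * (μ - m)) * ε ^ (2 * m) := by
    rw [← pow_add]; congr 1; omega
  have h4 : 0 ≤ C * ρ ^ μ := (abs_nonneg _).trans hc
  simp only [abs_mul, abs_inv, abs_pow, abs_of_pos hε]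
  calc |w| * (|cμ| * ε ^ (2 * μ)) * (|D|⁻¹ * |p|)
      ≤ 1 * (C * ρ ^ μ * ε ^ (2 * μ)) * ((δ / 2 * ε ^ (2 * m))⁻¹ * (432 ^ μ * G)) := by
        gcongr
    _ = _ := by
        rw [h3, mul_pow]
        generalize ε ^ (2 * (μ - m)) = e
        generalize (432 : ℝ) ^ μ = t
        have h5 : ε ^ (2 * m) ≠ 0 := by positivity
        field_simp

/-- For small `ε` the tangent coefficient lists have a basis whose kernel fields are the vector
spherical harmonics of degree at most `μ₀` up to a tail of higher degree and of size `O(ε ^ 2)`: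
the basis dual to the harmonics, scaled by the Mercer coefficients. -/
lemma exists_basis_near_vsh {n μ₀ : ℕ} {y : Fin n → S2} (hy : Unisolvent μ₀ y)
    {φ : ℝ → ℝ → ℝ} {c : ℕ → ℝ → ℝ}
    (hφ : ∀ᶠ ε in 𝓝[>] (0 : ℝ), ContDiff ℝ 2 (fun x : E3 => φ ε ‖x‖))
    (hexp : ∀ᶠ ε in 𝓝[>] (0 : ℝ), HasMercerExpansion (φ ε) ε (fun μ => c μ ε))
    (hupper : ∃ C ρ : ℝ, ∀ᶠ ε in 𝓝[>] (0 : ℝ), ∀ μ : ℕ, 1 ≤ μ → |c μ ε| ≤ C * ρ ^ μ)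
    (hlower : ∃ δ : ℝ, 0 < δ ∧
      ∀ᶠ ε in 𝓝[>] (0 : ℝ), ∀ μ : ℕ, 1 ≤ μ → μ ≤ μ₀ → δ ≤ |c μ ε|) :
    ∃ M κ : ℝ, 0 ≤ M ∧ ∀ᶠ ε in 𝓝[>] (0 : ℝ),
      ∃ (d : Module.Basis (vshIndex μ₀) ℝ (tangentSpace y)) (r : vshIndex μ₀ → ℕ → ℤ → ℝ),
        ∀ k : vshIndex μ₀,
          (∀ x : S2, HasSum
            (fun j : ℕ => ∑ ν ∈ Finset.Icc (-((μ₀ + 1 + j : ℕ) : ℤ)) ((μ₀ + 1 + j : ℕ) : ℤ),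
              r k (μ₀ + 1 + j) ν • vsh (μ₀ + 1 + j) ν x)
            (rbfField (φ ε) y (d k) x - vsh k.1.1 k.1.2 x)) ∧
          (∀ μ : ℕ, μ₀ < μ → ∀ ν : ℤ, |ν| ≤ (μ : ℤ) →
            |r k μ ν| ≤ M * κ ^ μ * ε ^ (2 * (μ - k.1.1))) ∧
          (∀ x : S2, ‖rbfField (φ ε) y (d k) x - vsh k.1.1 k.1.2 x‖ ≤ M * ε ^ 2) := by
  obtain ⟨C, ρ, hC⟩ := hupper
  obtain ⟨δ, hδ, hlow⟩ := hlower
  obtain ⟨β, hβ⟩ := hy.exists_dual_basis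
  set G : ℝ := ∑ k, ∑ j, ‖(β k : Fin n → E3) j‖ with hG
  have hGk : ∀ k, ∑ j, ‖(β k : Fin n → E3) j‖ ≤ G := fun k =>
    Finset.single_le_sum (f := fun k => ∑ j, ‖(β k : Fin n → E3) j‖)
      (fun k _ => by positivity) (Finset.mem_univ k)
  have hG0 : 0 ≤ G := by positivity
  set M₁ : ℝ := 2 * |C| * G / δ with hM₁
  have hM₁0 : 0 ≤ M₁ := by positivity
  set κ : ℝ := 432 * |ρ| with hκ
  have hκ0 : 0 ≤ κ := by positivity
  refine ⟨M₁ + 2 * M₁ * (1296 * κ) ^ (μ₀ + 1), κ, by positivity, ?_⟩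
  filter_upwards [hφ, hexp, hC, hlow, eventually_mul_sq_le (432 ^ 2 * |ρ|) one_half_pos,
    eventually_mul_sq_le (1296 * κ) one_half_pos, eventually_mul_sq_le 1 one_pos,
    self_mem_nhdsWithin] with ε hφ hexp hC hlow hε1 hε2 hε3 hεpos
  have hε0 : 0 < ε := hεpos
  have hε_le : ε ≤ 1 := by nlinarith
  have hC' : ∀ μ : ℕ, 1 ≤ μ → |c μ ε| ≤ |C| * |ρ| ^ μ := fun μ hμ => by
    refine (hC μ hμ).trans ((le_abs_self _).trans ?_)
    rw [abs_mul, abs_pow]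
  have hsum := summable_mercer_coeff (abs_nonneg ρ) hC' hε1
  set D : vshIndex μ₀ → ℝ := fun k => primeWeight k.1.2 * (c k.1.1 ε * ε ^ (2 * k.1.1)) with hD
  have hDlow : ∀ k, δ / 2 * ε ^ (2 * k.1.1) ≤ |D k| := by
    intro k
    have hk := mem_vshIndex.1 k.2
    have h1 := half_le_primeWeight k.1.2
    rw [hD]
    simp only [abs_mul, abs_pow, abs_of_pos hε0]
    rw [abs_of_nonneg (by linarith : (0 : ℝ) ≤ primeWeight k.1.2), ← mul_assoc]
    have h2 : δ / 2 ≤ primeWeight k.1.2 * |c k.1.1 ε| := by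
      calc δ / 2 = 1 / 2 * δ := by ring
        _ ≤ _ := mul_le_mul h1 (hlow _ hk.1.1 hk.1.2) hδ.le (by linarith)
    gcongr
  have hDpos : ∀ k, 0 < |D k| := fun k => lt_of_lt_of_le (by positivity) (hDlow k)
  have hDne : ∀ k, D k ≠ 0 := fun k => abs_pos.1 (hDpos k)
  let d := β.isUnitSMul (w := fun k => (D k)⁻¹) fun k => (inv_ne_zero (hDne k)).isUnit
  have hd : ∀ k, (d k : Fin n → E3) = (D k)⁻¹ • (β k : Fin n → E3) := fun k => by
    rw [Module.Basis.isUnitSMul_apply]; rfl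
  have hpair : ∀ k μ ν, nodePairing y μ ν (d k) = (D k)⁻¹ * nodePairing y μ ν (β k) := by
    intro k μ ν
    rw [hd]
    simp [nodePairing, inner_smul_right, Finset.mul_sum]
  set r : vshIndex μ₀ → ℕ → ℤ → ℝ := fun k μ ν =>
    primeWeight ν * (c μ ε * ε ^ (2 * μ)) * nodePairing y μ ν (d k) with hr
  have hexpand : ∀ (k : vshIndex μ₀) (x : S2), HasSum
      (fun j : ℕ => ∑ ν ∈ Finset.Icc (-((μ₀ + 1 + j : ℕ) : ℤ)) ((μ₀ + 1 + j : ℕ) : ℤ),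
        r k (μ₀ + 1 + j) ν • vsh (μ₀ + 1 + j) ν x)
      (rbfField (φ ε) y (d k) x - vsh k.1.1 k.1.2 x) := by
    intro k x
    refine hasSum_rbfField_sub_vsh hφ hexp hsum y (d k) k (fun k' => ?_) x
    rw [hpair, hβ]
    split_ifs with h
    · subst h
      rw [mul_one]
      exact mul_inv_cancel₀ (hDne k')
    · simp
  have hrb : ∀ (k : vshIndex μ₀) (μ : ℕ), μ₀ < μ → ∀ ν : ℤ, ν.natAbs ≤ μ →
      |r k μ ν| ≤ M₁ * κ ^ μ * ε ^ (2 * (μ - k.1.1)) := by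
    intro k μ hμ ν hν
    have hk := mem_vshIndex.1 k.2
    have h1 : |nodePairing y μ ν (β k)| ≤ 432 ^ μ * G :=
      (abs_nodePairing_le y hν _).trans (mul_le_mul_of_nonneg_left (hGk k) (by positivity))
    have h2 := abs_tail_coeff_le (by omega : k.1.1 ≤ μ) (abs_primeWeight_le ν)
      (hC' μ (by omega)) hδ hε0 (hDlow k) h1
    rw [← hpair] at h2
    exact h2
  clear_value κ M₁ r d
  refine ⟨d, r, fun k => ⟨hexpand k, fun μ hμ ν hν => ?_, fun x => ?_⟩⟩
  · have h1 := hrb k μ hμ ν (by rw [abs_le] at hν; omega)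
    have h2 : 0 ≤ 2 * M₁ * (1296 * κ) ^ (μ₀ + 1) * (κ ^ μ * ε ^ (2 * (μ - k.1.1))) := by
      positivity
    linarith
  · have h1 := norm_tail_le (mem_vshIndex.1 k.2).1.2 hM₁0 hκ0 hε0.le hε_le hε2 (hrb k)
      (hexpand k x)
    have h2 : 0 ≤ M₁ * ε ^ 2 := by positivity
    linarith

lemma rbfField_eq_sum {n : ℕ} {ι : Type*} [Fintype ι] (ψ : ℝ → ℝ) {y : Fin n → S2}
    (d : Module.Basis ι ℝ (tangentSpace y)) (a : tangentSpace y) (x : S2) :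
    rbfField ψ y a x = ∑ k, d.repr a k • rbfField ψ y (d k) x := by
  have h : rbfLin ψ y a = ∑ k, d.repr a k • rbfLin ψ y (d k) := by
    conv_lhs => rw [← d.sum_repr a, map_sum]
    simp only [map_smul]
  have := congrFun h x
  rwa [Finset.sum_apply] at this

end DivFreeRBF

end

/-! ### Interpolation and its flat limit -/

open DivFreeRBF in
theorem mainTheorem1 (n μ₀ : ℕ) (hn : 2 * n = μ₀ * (μ₀ + 2))
    (y : Fin n → DivFreeRBF.S2) (hy : DivFreeRBF.Unisolvent μ₀ y)
    (φ : ℝ → ℝ → ℝ) (c : ℕ → ℝ → ℝ)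
    (hφ : ∀ᶠ ε in 𝓝[>] (0 : ℝ), ContDiff ℝ 2 (fun x : DivFreeRBF.E3 => φ ε ‖x‖))
    (hexp : ∀ᶠ ε in 𝓝[>] (0 : ℝ), DivFreeRBF.HasMercerExpansion (φ ε) ε (fun μ => c μ ε))
    (hupper : ∃ C ρ : ℝ, ∀ᶠ ε in 𝓝[>] (0 : ℝ), ∀ μ : ℕ, 1 ≤ μ → |c μ ε| ≤ C * ρ ^ μ)
    (hlower : ∃ δ : ℝ, 0 < δ ∧
      ∀ᶠ ε in 𝓝[>] (0 : ℝ), ∀ μ : ℕ, 1 ≤ μ → μ ≤ μ₀ → δ ≤ |c μ ε|) :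
    (∃ M κ : ℝ, ∀ᶠ ε in 𝓝[>] (0 : ℝ),
      ∃ (b : Module.Basis (DivFreeRBF.vshIndex μ₀) ℝ (DivFreeRBF.kernelSpace (φ ε) y))
        (r : DivFreeRBF.vshIndex μ₀ → ℕ → ℤ → ℝ),
        ∀ k : DivFreeRBF.vshIndex μ₀,
          (∀ x : DivFreeRBF.S2, HasSum
            (fun j : ℕ => ∑ ν ∈ Finset.Icc (-((μ₀ + 1 + j : ℕ) : ℤ)) ((μ₀ + 1 + j : ℕ) : ℤ),
              r k (μ₀ + 1 + j) ν • DivFreeRBF.vsh (μ₀ + 1 + j) ν x)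
            ((b k : DivFreeRBF.S2 → DivFreeRBF.E3) x - DivFreeRBF.vsh k.1.1 k.1.2 x)) ∧
          (∀ μ : ℕ, μ₀ < μ → ∀ ν : ℤ, |ν| ≤ (μ : ℤ) →
            |r k μ ν| ≤ M * κ ^ μ * ε ^ (2 * (μ - k.1.1))) ∧
          (∀ x : DivFreeRBF.S2,
            ‖(b k : DivFreeRBF.S2 → DivFreeRBF.E3) x - DivFreeRBF.vsh k.1.1 k.1.2 x‖
              ≤ M * ε ^ 2)) ∧
    (∀ᶠ ε in 𝓝[>] (0 : ℝ), ∀ u : Fin n → DivFreeRBF.E3, DivFreeRBF.IsTangent y u →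
      ∃! a : Fin n → DivFreeRBF.E3, DivFreeRBF.IsTangent y a ∧
        ∀ i, DivFreeRBF.rbfField (φ ε) y a (y i) = u i) ∧
    (∀ u : Fin n → DivFreeRBF.E3, DivFreeRBF.IsTangent y u →
      ∃ p ∈ DivFreeRBF.vshSpace μ₀, (∀ i, p (y i) = u i) ∧
        (∀ q ∈ DivFreeRBF.vshSpace μ₀, (∀ i, q (y i) = u i) → q = p) ∧
        ∀ s : ℝ → DivFreeRBF.S2 → DivFreeRBF.E3,
          (∀ᶠ ε in 𝓝[>] (0 : ℝ), DivFreeRBF.IsRBFInterpolant (φ ε) y u (s ε)) →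
          TendstoUniformly s p (𝓝[>] (0 : ℝ))) := by
  obtain ⟨M, κ, hM, hbasis⟩ := exists_basis_near_vsh hy hφ hexp hupper hlower
  obtain ⟨K, hK, hstab⟩ := hy.exists_stability
  have hsmall : ∀ᶠ ε in 𝓝[>] (0 : ℝ), K * (M * ε ^ 2) ≤ 1 / 2 := by
    simpa only [mul_assoc] using eventually_mul_sq_le (K * M) one_half_pos
  have hinj : ∀ᶠ ε in 𝓝[>] (0 : ℝ), Function.Injective (rbfEval (φ ε) y) := by
    filter_upwards [hbasis, hsmall] with ε ⟨d, r, hd⟩ hε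
    refine (injective_iff_map_eq_zero _).2 fun a ha => ?_
    -- Stability with zero data.
    have h := hstab (M * ε ^ 2) (by positivity) hε (fun k => rbfField (φ ε) y (d k))
      (fun k => (hd k).2.2) (fun k => d.repr a k) 0 (fun i => by
        rw [← rbfField_eq_sum]
        have h0 : rbfField (φ ε) y a (y i) = 0 := congrFun (congrArg Subtype.val ha) i
        rw [h0]
        simp)
    simp only [Pi.zero_apply, abs_zero, Finset.sum_const_zero, mul_zero, sub_zero] at h
    refine d.ext_elem_iff.2 fun k => ?_
    have h1 := (Finset.single_le_sum (f := fun k => |d.repr a k|) (fun k _ => abs_nonneg _)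
      (Finset.mem_univ k)).trans h
    simpa using h1
  refine ⟨⟨M, κ, ?_⟩, ?_, fun u hu => ?_⟩
  · filter_upwards [hbasis, hinj] with ε ⟨d, r, hd⟩ hinj
    refine ⟨d.map ((LinearEquiv.ofInjective (rbfLin (φ ε) y)
      (rbfLin_injective_of_rbfEval hinj)).trans (LinearEquiv.ofEq _ _ (range_rbfLin (φ ε) y))),
      r, fun k => ?_⟩
    exact hd k
  · filter_upwards [hinj] with ε hinj u hu
    exact existsUnique_interpolant_of_injective hinj hu
  · obtain ⟨a₀, ha₀, huniq⟩ := hy u hu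
    refine ⟨∑ k, a₀ k • vsh k.1.1 k.1.2,
      (Submodule.mem_span_range_iff_exists_fun ℝ).2 ⟨a₀, rfl⟩, fun i => ?_, ?_, fun s hs => ?_⟩
    · rw [Finset.sum_apply]; exact ha₀ i
    · intro q hq hqu
      obtain ⟨a, rfl⟩ := (Submodule.mem_span_range_iff_exists_fun ℝ).1 hq
      rw [huniq a fun i => by rw [← hqu i, Finset.sum_apply]; rfl]
    · set A : ℝ := ∑ k, |a₀ k| with hA
      have hA0 : 0 ≤ A := by positivity
      -- The distance of interpolant and limit is at most `X ε ^ 2` for this constant `X`.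
      set X : ℝ := 432 ^ μ₀ * (2 * (K * M) * A) + M * (2 * A) with hX
      rw [Metric.tendstoUniformly_iff]
      intro t ht
      filter_upwards [hbasis, hsmall, hs, eventually_mul_sq_le X (half_pos ht)]
        with ε ⟨d, r, hd⟩ hε ⟨a, hat, hsa, hsu⟩ hXε x
      set b : vshIndex μ₀ → ℝ := fun k => d.repr ⟨a, hat⟩ k with hb
      have hsx : ∀ x, s ε x = ∑ k, b k • rbfField (φ ε) y (d k) x := fun x => by
        rw [hsa]; exact rbfField_eq_sum (φ ε) d ⟨a, hat⟩ x
      have h := hstab (M * ε ^ 2) (by positivity) hε (fun k => rbfField (φ ε) y (d k))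
        (fun k => (hd k).2.2) b a₀ (fun i => by rw [← hsx, hsu, ha₀])
      have hbA : ∑ k, |b k| ≤ 2 * A := by
        have h3 : ∑ k, |b k| ≤ ∑ k, |b k - a₀ k| + A := by
          rw [hA, ← Finset.sum_add_distrib]
          refine Finset.sum_le_sum fun k _ => ?_
          have := abs_add_le (b k - a₀ k) (a₀ k)
          rwa [sub_add_cancel] at this
        nlinarith [mul_le_mul_of_nonneg_right hε hA0]
      have hdist : dist ((∑ k, a₀ k • vsh k.1.1 k.1.2 : S2 → E3) x) (s ε x) ≤ X * ε ^ 2 := by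
        rw [dist_comm, dist_eq_norm, hsx, Finset.sum_apply]
        have hsplit : ∑ k, b k • rbfField (φ ε) y (d k) x -
            ∑ k, (a₀ k • vsh k.1.1 k.1.2 : S2 → E3) x =
            ∑ k, (b k - a₀ k) • vsh k.1.1 k.1.2 x +
              ∑ k, b k • (rbfField (φ ε) y (d k) x - vsh k.1.1 k.1.2 x) := by
          simp only [sub_smul, smul_sub, Finset.sum_sub_distrib, Pi.smul_apply]
          abel
        rw [hsplit]
        have h1 := norm_sum_smul_le (fun k => b k - a₀ k) (f := fun k => vsh k.1.1 k.1.2 x)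
          (η := 432 ^ μ₀) fun k => by
            have hk := mem_vshIndex.1 k.2
            exact (norm_vsh_le hk.2 x).trans (pow_le_pow_right₀ (by norm_num) hk.1.2)
        have h2 := norm_sum_smul_le b (η := M * ε ^ 2) fun k => (hd k).2.2 x
        calc _ ≤ 432 ^ μ₀ * ∑ k, |b k - a₀ k| + M * ε ^ 2 * ∑ k, |b k| :=
              (norm_add_le _ _).trans (add_le_add h1 h2)
          _ ≤ 432 ^ μ₀ * (2 * (K * (M * ε ^ 2)) * A) + M * ε ^ 2 * (2 * A) := by gcongr
          _ = X * ε ^ 2 := by rw [hX]; ring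
      linarith
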